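/- Let $\epsilon_1,\epsilon_2\in\{1,-1\}$ and $\delta_1,\delta_2\in\mathbb R$, and consider the Davey–Stewartson system $$i\psi_t+\psi_{xx}+\epsilon_1\psi_{yy}=\epsilon_2|\psi|^2\psi+\psi\varphi_y,\qquad \varphi_{xx}+\delta_1\varphi_{yy}=\delta_2(|\psi|^2)_y,$$ with $\psi=u+iv$ and real $u,v,\varphi$. Its symmetry algebra $L$ is the set of smooth vector fields on the space $\mathbb R^6$ of the variables $(t,x,y,u,v,\varphi)$ whose second prolongation annihilates the system at every second-order jet satisfying it. For $\tau,\alpha,\beta,\mu,\gamma,\delta\in C^\infty(\mathbb R)$ (functions of $t$; dots are $t$-derivatives) put $$\begin{aligned} \mathcal X(\tau)&=\tau\partial_t+\tfrac{\dot\tau}{2}(x\partial_x+y\partial_y-u\partial_u-v\partial_v-\varphi\partial_\varphi)-\tfrac{x^2+\epsilon_1y^2}{8}\ddot\tau\,(v\partial_u-u\partial_v)-\tfrac{\dddot\tau}{8}\bigl(x^2y+\tfrac{\epsilon_1}{3}y^3\bigr)\partial_\varphi,\\ \mathcal Y(\alpha)&=\alpha\partial_x-\tfrac x2\dot\alpha\,(v\partial_u-u\partial_v)-\tfrac{xy}{2}\ddot\alpha\,\partial_\varphi,\\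 \mathcal Z(\beta)&=\beta\partial_y-\tfrac{y}{2\epsilon_1}\dot\beta\,(v\partial_u-u\partial_v)+\tfrac{\ddot\beta}{4\epsilon_1}(\delta_1x^2-y^2)\partial_\varphi,\\ \mathcal W(\mu)&=\mu(v\partial_u-u\partial_v)+y\dot\mu\,\partial_\varphi,\qquad \mathcal R(\gamma)=x\gamma\,\partial_\varphi,\qquad \mathcal S(\delta)=\delta\,\partial_\varphi . \end{aligned}$$ Then: (1) $L$ is a Lie algebra under the commutator of vector fields, and it consists exactly of the vector fields $\mathcal X(\tau)+\mathcal Y(\alpha)+\mathcal Z(\beta)+\mathcal W(\mu)+\mathcal R(\gamma)+\mathcal S(\delta)$ with $(\epsilon_1+\delta_1)\dddot\tau=0$; the six functions are determined by the vector field. Hence $\tau$ is arbitrary if $\delta_1=-\epsilon_1$, while $\tau$ is exactly a quadratic $\tau_2t^2+\tau_1t+\tau_0$ if $\delta_1\ne-\epsilon_1$. (2) For all $\tau,\tau_1,\tau_2$ satisfying this restriction and all other functions, $$\begin{aligned} &[\mathcal X(\tau_1),\mathcal X(\tau_2)]=\mathcal X(\tau_1\dot\tau_2-\dot\tau_1\tau_2),&&[\mathcal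 X(\tau),\mathcal Y(\alpha)]=\mathcal Y(\tau\dot\alpha-\tfrac12\dot\tau\alpha),\\ &[\mathcal X(\tau),\mathcal Z(\beta)]=\mathcal Z(\tau\dot\beta-\tfrac12\dot\tau\beta),&&[\mathcal X(\tau),\mathcal W(\mu)]=\mathcal W(\tau\dot\mu),\\ &[\mathcal X(\tau),\mathcal R(\gamma)]=\mathcal R(\tau\dot\gamma+\dot\tau\gamma),&&[\mathcal X(\tau),\mathcal S(\delta)]=\mathcal S(\tau\dot\delta+\tfrac12\dot\tau\delta),\\ &[\mathcal Y(\alpha_1),\mathcal Y(\alpha_2)]=-\tfrac12\mathcal W(\alpha_1\dot\alpha_2-\dot\alpha_1\alpha_2),&&[\mathcal Z(\beta_1),\mathcal Z(\beta_2)]=-\tfrac{\epsilon_1}2\mathcal W(\beta_1\dot\beta_2-\dot\beta_1\beta_2),\\ &[\mathcal Y(\alpha),\mathcal Z(\beta)]=\tfrac12\mathcal R(\ddot\alpha\beta+\delta_1\epsilon_1\alpha\ddot\beta),&&[\mathcal Y(\alpha),\mathcal R(\gamma)]=\mathcal S(\alpha\gamma),\\ &[\mathcal Z(\beta),\mathcal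 W(\mu)]=\mathcal S(\beta\dot\mu), \end{aligned}$$ and all other commutators of the generators vanish. (3) If $\delta_1=-\epsilon_1$, then $L$ is infinite-dimensional and has the Levi decomposition $$L=\{\mathcal X(\tau)\}\ltimes\{\mathcal Y(\alpha),\mathcal Z(\beta),\mathcal W(\mu),\mathcal R(\gamma),\mathcal S(\delta)\},$$ that is, $\mathfrak s=\{\mathcal X(\tau)\}$ is a subalgebra without nonzero solvable ideals, $\mathfrak n=\{\mathcal Y(\alpha)+\mathcal Z(\beta)+\mathcal W(\mu)+\mathcal R(\gamma)+\mathcal S(\delta)\}$ is a solvable ideal and the radical of $L$, and $L=\mathfrak s\oplus\mathfrak n$ as a vector space. Moreover $L$ is of (centreless) Kac–Moody–Virasoro type: for some $n$ it embeds as a Lie algebra into the semidirect sum of the Virasoro algebra of vector fields $\tau(t)\,d/dt$, $\tau\in C^\infty(\mathbb R)$, and the current algebra $\mathfrak{sl}(n,\mathbb R)\otimes C^\infty(\mathbb R)$, on which $\tau\,d/dt$ acts by $A\mapsto\tau\dot A$, in such a way that the projection to the Virasoro algebra maps $\mathfrak s$ isomorphically onto it, and that the infinite-dimensional ideal $\mathfrak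 n$ is the set of elements mapped into the current algebra. -/

import Mathlib

open scoped ContDiff

noncomputable section

namespace DaveyStewartson

/-! ### Smooth functions of time -/

/-- The algebra `C^∞(ℝ)` of smooth real functions of the time `t`. -/
def smoothFun : Subalgebra ℝ (ℝ → ℝ) where
  carrier := {f | ContDiff ℝ ∞ f}
  mul_mem' {f g} (hf : ContDiff ℝ ∞ f) (hg : ContDiff ℝ ∞ g) := hf.mul hg
  add_mem' {f g} (hf : ContDiff ℝ ∞ f) (hg : ContDiff ℝ ∞ g) := hf.add hg
  algebraMap_mem' c := (contDiff_const : ContDiff ℝ ∞ fun _ : ℝ => c)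

/-- The type of smooth real functions of the time `t`. -/
abbrev C : Type := smoothFun

theorem C.contDiff (f : C) : ContDiff ℝ ∞ (f : ℝ → ℝ) := f.2

theorem C.differentiable (f : C) : Differentiable ℝ (f : ℝ → ℝ) :=
  f.contDiff.differentiable (by simp)

/-- The time derivative `d/dt`, as a derivation of `C^∞(ℝ)`. -/
def D : Derivation ℝ C C where
  toFun f := ⟨deriv f.1, (contDiff_infty_iff_deriv.1 f.2).2⟩
  map_add' f g := by
    ext t
    exact deriv_add (f.differentiable t) (g.differentiable t)
  map_smul' c f := by
    ext t
    exact deriv_const_mul c (f.differentiable t)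
  map_one_eq_zero' := by
    ext t
    exact deriv_const t (1 : ℝ)
  leibniz' f g := by
    ext t
    have h := deriv_mul (f.differentiable t) (g.differentiable t)
    change deriv (f.1 * g.1) t = f.1 t * deriv g.1 t + g.1 t * deriv f.1 t
    rw [h]
    ring

/-! ### The Lie algebra of smooth vector fields on the space of variables -/

/-- The space of the independent variables `(t, x, y)` and the dependent variables `(u, v, φ)`:
for `z : J0`, `z.1 0, z.1 1, z.1 2` are `t, x, y` and `z.2 0, z.2 1, z.2 2` are `u, v, φ`. -/
abbrev J0 : Type := (Fin 3 → ℝ) × (Fin 3 → ℝ)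

/-- The smooth vector fields on the space of variables. -/
def smoothVF : Submodule ℝ (J0 → J0) where
  carrier := {V | ContDiff ℝ ∞ V}
  add_mem' {V W} (hV : ContDiff ℝ ∞ V) (hW : ContDiff ℝ ∞ W) := hV.add hW
  zero_mem' := (contDiff_const : ContDiff ℝ ∞ fun _ : J0 => (0 : J0))
  smul_mem' c V (hV : ContDiff ℝ ∞ V) := hV.const_smul c

/-- The type of smooth vector fields on the space of variables. -/
abbrev VF : Type := smoothVF

theorem VF.contDiff (V : VF) : ContDiff ℝ ∞ (V : J0 → J0) := V.2

theorem VF.differentiable (V : VF) : Differentiable ℝ (V : J0 → J0) :=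
  V.contDiff.differentiable (by simp)

/-- The commutator of vector fields. -/
instance : Bracket VF VF where
  bracket V W := ⟨VectorField.lieBracket ℝ V.1 W.1,
    show ContDiff ℝ ∞ _ from V.contDiff.lieBracket_vectorField W.contDiff le_rfl⟩

theorem bracket_apply (V W : VF) (z : J0) :
    (⁅V, W⁆ : VF).1 z = fderiv ℝ W.1 z (V.1 z) - fderiv ℝ V.1 z (W.1 z) := rfl

instance : LieRing VF where
  add_lie U V W := by
    ext1; funext z
    exact VectorField.lieBracket_add_left (U.differentiable z) (V.differentiable z)
  lie_add U V W := by
    ext1; funext z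
    exact VectorField.lieBracket_add_right (V.differentiable z) (W.differentiable z)
  lie_self U := by
    ext1
    exact VectorField.lieBracket_self
  leibniz_lie U V W := by
    ext1; funext z
    exact VectorField.leibniz_identity_lieBracket (n := ∞)
      (by rw [minSmoothness_of_isRCLikeNormedField]; exact WithTop.coe_le_coe.2 le_top)
      U.contDiff.contDiffAt V.contDiff.contDiffAt W.contDiff.contDiffAt

instance : LieAlgebra ℝ VF where
  lie_smul c U V := by
    ext1; funext z
    exact VectorField.lieBracket_const_smul_right (V.differentiable z)

/-! ### Jets, prolongation and infinitesimal symmetries -/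

/-- First-order jets: a point `z` of `J0` and the first derivatives, `p a i = ∂ᵢ wᵃ`, where
`w = (u, v, φ)` and `∂₀, ∂₁, ∂₂` are `∂_t, ∂_x, ∂_y`. -/
abbrev J1 : Type := J0 × (Fin 3 → Fin 3 → ℝ)

/-- Second-order jets: a first-order jet and the second derivatives `q a i k = ∂ᵢ ∂ₖ wᵃ`. The jets
of functions are those with `q a i k = q a k i`. -/
abbrev J2 : Type := J1 × (Fin 3 → Fin 3 → Fin 3 → ℝ)

/-- The total derivative `Dᵢ F` of a function `F` of the variables. -/
def totalD0 (F : J0 → ℝ) (i : Fin 3) : J1 → ℝ := fun j =>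
  fderiv ℝ F j.1 (Pi.single i 1, fun a => j.2 a i)

/-- The total derivative `Dᵢ G` of a function `G` of the variables and the first derivatives. -/
def totalD1 (G : J1 → ℝ) (i : Fin 3) : J2 → ℝ := fun j =>
  fderiv ℝ G j.1 ((Pi.single i 1, fun a => j.1.2 a i), fun a k => j.2 a k i)

/-- For `V = Σ ξᵏ ∂ₖ + Σ ηᵃ ∂_{wᵃ}`, the coefficient of `∂_{wᵃᵢ}` in the prolongation of `V`:
`Dᵢ ηᵃ - Σₖ (Dᵢ ξᵏ) wᵃₖ`. -/
def prol1 (V : J0 → J0) (a i : Fin 3) : J1 → ℝ := fun j =>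
  totalD0 (fun z => (V z).2 a) i j - ∑ k, totalD0 (fun z => (V z).1 k) i j * j.2 a k

/-- The coefficient of `∂_{wᵃᵢₗ}` in the prolongation of `V`: `Dₗ ηᵃᵢ - Σₖ (Dₗ ξᵏ) wᵃᵢₖ`, where
`ηᵃᵢ` is the coefficient of `∂_{wᵃᵢ}`. -/
def prol2 (V : J0 → J0) (a i l : Fin 3) : J2 → ℝ := fun j =>
  totalD1 (prol1 V a i) l j - ∑ k, totalD0 (fun z => (V z).1 k) l j.1 * j.2 a i k

/-- The second prolongation `pr⁽²⁾ V`, a vector field on the space of second-order jets. -/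
def prolongation (V : J0 → J0) : J2 → J2 := fun j =>
  ((V j.1.1, fun a i => prol1 V a i j.1), fun a i l => prol2 V a i l j)

/-- The left-hand sides (minus the right-hand sides) of the Davey–Stewartson system
`i ψ_t + ψ_xx + ε₁ ψ_yy = ε₂ |ψ|² ψ + ψ φ_y`, `φ_xx + δ₁ φ_yy = δ₂ (|ψ|²)_y` with `ψ = u + i v`,
as functions on second-order jets: the real and the imaginary part of the first equation, and the
second equation, in which `(|ψ|²)_y = 2 (u u_y + v v_y)`. -/
def system (ε₁ ε₂ δ₁ δ₂ : ℝ) (j : J2) : Fin 3 → ℝ :=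
  let w := j.1.1.2
  let p := j.1.2
  let q := j.2
  let ψ : ℂ := ⟨w 0, w 1⟩
  let ψt : ℂ := ⟨p 0 0, p 1 0⟩
  let ψxx : ℂ := ⟨q 0 1 1, q 1 1 1⟩
  let ψyy : ℂ := ⟨q 0 2 2, q 1 2 2⟩
  let e : ℂ := Complex.I * ψt + ψxx + ε₁ * ψyy
    - (ε₂ * (Complex.normSq ψ : ℂ) * ψ + ψ * (p 2 2 : ℂ))
  ![e.re, e.im, q 2 1 1 + δ₁ * q 2 2 2 - δ₂ * (2 * (w 0 * p 0 2 + w 1 * p 1 2))]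

/-- `V` is an infinitesimal Lie point symmetry of the Davey–Stewartson system: its second
prolongation annihilates the system at all second-order jets that satisfy the system. -/
def IsSymmetry (ε₁ ε₂ δ₁ δ₂ : ℝ) (V : VF) : Prop :=
  ∀ j : J2, (∀ a i k, j.2 a i k = j.2 a k i) → system ε₁ ε₂ δ₁ δ₂ j = 0 →
    fderiv ℝ (system ε₁ ε₂ δ₁ δ₂) j (prolongation V.1 j) = 0

/-! ### The generators

A vector field is given by the list `(τ, ξ, η; U, V, Φ)` of its coefficients at
`∂_t, ∂_x, ∂_y; ∂_u, ∂_v, ∂_φ`. -/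

theorem contDiff_mk {a b c d e f : J0 → ℝ} (ha : ContDiff ℝ ∞ a) (hb : ContDiff ℝ ∞ b)
    (hc : ContDiff ℝ ∞ c) (hd : ContDiff ℝ ∞ d) (he : ContDiff ℝ ∞ e) (hf : ContDiff ℝ ∞ f) :
    ContDiff ℝ ∞ (fun z : J0 => ((![a z, b z, c z], ![d z, e z, f z]) : J0)) := by
  refine ContDiff.prodMk ?_ ?_
  · refine contDiff_pi.2 fun i => ?_
    fin_cases i
    exacts [ha, hb, hc]
  · refine contDiff_pi.2 fun i => ?_
    fin_cases i
    exacts [hd, he, hf]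

/-- `X(τ) = τ ∂_t + (τ'/2)(x ∂_x + y ∂_y - u ∂_u - v ∂_v - φ ∂_φ)
  - ((x² + ε₁ y²)/8) τ'' (v ∂_u - u ∂_v) - (τ'''/8)(x² y + (ε₁/3) y³) ∂_φ`. -/
def X (ε₁ : ℝ) (τ : C) : VF :=
  ⟨fun z =>
    let t := z.1 0; let x := z.1 1; let y := z.1 2
    let u := z.2 0; let v := z.2 1; let φ := z.2 2
    (![τ.1 t, (D τ).1 t / 2 * x, (D τ).1 t / 2 * y],
     ![-((D τ).1 t / 2 * u) - (x ^ 2 + ε₁ * y ^ 2) / 8 * (D (D τ)).1 t * v,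
       -((D τ).1 t / 2 * v) + (x ^ 2 + ε₁ * y ^ 2) / 8 * (D (D τ)).1 t * u,
       -((D τ).1 t / 2 * φ) - (D (D (D τ))).1 t / 8 * (x ^ 2 * y + ε₁ / 3 * y ^ 3)]), by
    obtain ⟨f3, h3 : ContDiff ℝ ∞ f3⟩ := D (D (D τ))
    obtain ⟨f2, h2 : ContDiff ℝ ∞ f2⟩ := D (D τ)
    obtain ⟨f1, h1 : ContDiff ℝ ∞ f1⟩ := D τ
    obtain ⟨f0, h0 : ContDiff ℝ ∞ f0⟩ := τ
    dsimp only
    exact contDiff_mk (by fun_prop) (by fun_prop) (by fun_prop) (by fun_prop) (by fun_prop)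
      (by fun_prop)⟩

/-- `Y(α) = α ∂_x - (x/2) α' (v ∂_u - u ∂_v) - (x y/2) α'' ∂_φ`. -/
def Y (α : C) : VF :=
  ⟨fun z =>
    let t := z.1 0; let x := z.1 1; let y := z.1 2
    let u := z.2 0; let v := z.2 1
    (![0, α.1 t, 0],
     ![-(x / 2 * (D α).1 t * v), x / 2 * (D α).1 t * u, -(x * y / 2 * (D (D α)).1 t)]), by
    obtain ⟨f2, h2 : ContDiff ℝ ∞ f2⟩ := D (D α)
    obtain ⟨f1, h1 : ContDiff ℝ ∞ f1⟩ := D α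
    obtain ⟨f0, h0 : ContDiff ℝ ∞ f0⟩ := α
    dsimp only
    exact contDiff_mk (by fun_prop) (by fun_prop) (by fun_prop) (by fun_prop) (by fun_prop)
      (by fun_prop)⟩

/-- `Z(β) = β ∂_y - (y/(2 ε₁)) β' (v ∂_u - u ∂_v) + (β''/(4 ε₁))(δ₁ x² - y²) ∂_φ`. -/
def Z (ε₁ δ₁ : ℝ) (β : C) : VF :=
  ⟨fun z =>
    let t := z.1 0; let x := z.1 1; let y := z.1 2
    let u := z.2 0; let v := z.2 1
    (![0, 0, β.1 t],
     ![-(y / (2 * ε₁) * (D β).1 t * v), y / (2 * ε₁) * (D β).1 t * u,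
       (D (D β)).1 t / (4 * ε₁) * (δ₁ * x ^ 2 - y ^ 2)]), by
    obtain ⟨f2, h2 : ContDiff ℝ ∞ f2⟩ := D (D β)
    obtain ⟨f1, h1 : ContDiff ℝ ∞ f1⟩ := D β
    obtain ⟨f0, h0 : ContDiff ℝ ∞ f0⟩ := β
    dsimp only
    exact contDiff_mk (by fun_prop) (by fun_prop) (by fun_prop) (by fun_prop) (by fun_prop)
      (by fun_prop)⟩

/-- `W(μ) = μ (v ∂_u - u ∂_v) + y μ' ∂_φ`. -/
def W (μ : C) : VF :=
  ⟨fun z =>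
    let t := z.1 0; let y := z.1 2
    let u := z.2 0; let v := z.2 1
    (![0, 0, 0], ![μ.1 t * v, -(μ.1 t * u), y * (D μ).1 t]), by
    obtain ⟨f1, h1 : ContDiff ℝ ∞ f1⟩ := D μ
    obtain ⟨f0, h0 : ContDiff ℝ ∞ f0⟩ := μ
    dsimp only
    exact contDiff_mk (by fun_prop) (by fun_prop) (by fun_prop) (by fun_prop) (by fun_prop)
      (by fun_prop)⟩

/-- `R(γ) = x γ ∂_φ`. -/
def R (γ : C) : VF :=
  ⟨fun z => (![0, 0, 0], ![0, 0, z.1 1 * γ.1 (z.1 0)]), by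
    obtain ⟨f0, h0 : ContDiff ℝ ∞ f0⟩ := γ
    dsimp only
    exact contDiff_mk (by fun_prop) (by fun_prop) (by fun_prop) (by fun_prop) (by fun_prop)
      (by fun_prop)⟩

/-- `S(δ) = δ ∂_φ`. -/
def S (δ : C) : VF :=
  ⟨fun z => (![0, 0, 0], ![0, 0, δ.1 (z.1 0)]), by
    obtain ⟨f0, h0 : ContDiff ℝ ∞ f0⟩ := δ
    dsimp only
    exact contDiff_mk (by fun_prop) (by fun_prop) (by fun_prop) (by fun_prop) (by fun_prop)
      (by fun_prop)⟩

/-! ### Centreless Kac–Moody–Virasoro algebras -/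

/-- The centreless Virasoro algebra over `C^∞(ℝ)`: the smooth vector fields `τ(t) d/dt` on the line,
with `[τ₁, τ₂] = τ₁ τ₂' - τ₁' τ₂`. -/
def Vir : Type := C

instance : AddCommGroup Vir := inferInstanceAs (AddCommGroup C)

instance : Module ℝ Vir := inferInstanceAs (Module ℝ C)

/-- The vector field `τ(t) d/dt` with the coefficient `τ`. -/
def Vir.of : C ≃ₗ[ℝ] Vir := LinearEquiv.refl ℝ C

/-- The coefficient of a vector field on the line. -/
def Vir.coeff : Vir ≃ₗ[ℝ] C := LinearEquiv.refl ℝ C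

instance : Bracket Vir Vir where
  bracket a b := Vir.of (a.coeff * D b.coeff - D a.coeff * b.coeff)

theorem Vir.coeff_lie (a b : Vir) :
    Vir.coeff ⁅a, b⁆ = a.coeff * D b.coeff - D a.coeff * b.coeff := rfl

instance : LieRing Vir where
  add_lie a b c := by
    apply Vir.coeff.injective
    simp only [Vir.coeff_lie, map_add]
    ring
  lie_add a b c := by
    apply Vir.coeff.injective
    simp only [Vir.coeff_lie, map_add]
    ring
  lie_self a := by
    apply Vir.coeff.injective
    simp only [Vir.coeff_lie, map_zero]
    ring
  leibniz_lie a b c := by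
    apply Vir.coeff.injective
    simp only [Vir.coeff_lie, map_add, map_sub, Derivation.leibniz, smul_eq_mul]
    ring

instance : LieAlgebra ℝ Vir where
  lie_smul c a b := by
    apply Vir.coeff.injective
    rw [Vir.coeff_lie, map_smul Vir.coeff, map_smul Vir.coeff, Vir.coeff_lie, D.map_smul,
      Algebra.mul_smul_comm, Algebra.mul_smul_comm, smul_sub]

attribute [local instance 100] LieRing.ofAssociativeRing LieAlgebra.ofAssociativeAlgebra

/-- The centreless Kac–Moody (current) algebra `sl(n, ℝ) ⊗ C^∞(ℝ)`: the trace-free matrices of smooth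
functions of `t`, with the pointwise commutator. -/
def Current (n : ℕ) : LieSubalgebra ℝ (Matrix (Fin n) (Fin n) C) where
  carrier := {A | A.trace = 0}
  add_mem' {A B} (hA : A.trace = 0) (hB : B.trace = 0) := by
    change (A + B).trace = 0
    rw [Matrix.trace_add, hA, hB, add_zero]
  zero_mem' := Matrix.trace_zero _ _
  smul_mem' c A (hA : A.trace = 0) := by
    change (c • A).trace = 0
    rw [Matrix.trace_smul, hA, smul_zero]
  lie_mem' {A B} _ _ := by
    change (A * B - B * A).trace = 0
    rw [Matrix.trace_sub, Matrix.trace_mul_comm, sub_self]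

instance (n : ℕ) : LieRing (Current n) := inferInstance

instance (n : ℕ) : LieAlgebra ℝ (Current n) := inferInstance

instance (n : ℕ) : AddCommGroup (Current n) := LieRing.toAddCommGroup

instance (n : ℕ) : AddCommSemigroup (Current n) := inferInstance

/-- The action `A ↦ τ A'` of a vector field `τ d/dt` on the line on the current algebra. -/
def Vir.act (n : ℕ) : Vir →ₗ⁅ℝ⁆ LieDerivation ℝ (Current n) (Current n) where
  toFun a :=
    { toFun := fun A => ⟨A.1.map fun f => a.coeff * D f, by
        have h : A.1.trace = 0 := A.2
        change Matrix.trace _ = 0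
        simp only [Matrix.trace, Matrix.diag_apply, Matrix.map_apply] at h ⊢
        rw [← Finset.mul_sum, ← map_sum, h, map_zero, mul_zero]⟩
      map_add' := fun A B => by
        ext1; ext1 i k
        change a.coeff * D (A.1 i k + B.1 i k) = a.coeff * D (A.1 i k) + a.coeff * D (B.1 i k)
        rw [map_add, mul_add]
      map_smul' := fun c A => by
        ext1; ext1 i k
        change a.coeff * D (c • A.1 i k) = c • (a.coeff * D (A.1 i k))
        rw [D.map_smul, Algebra.mul_smul_comm]
      leibniz' := fun A B => by
        ext1; ext1 i k
        change a.coeff * D ((A.1 * B.1 - B.1 * A.1) i k)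
          = (A.1 * (B.1.map fun f => a.coeff * D f) - (B.1.map fun f => a.coeff * D f) * A.1) i k
          - (B.1 * (A.1.map fun f => a.coeff * D f) - (A.1.map fun f => a.coeff * D f) * B.1) i k
        simp only [Matrix.sub_apply, Matrix.mul_apply, Matrix.map_apply, map_sub, map_sum,
          Derivation.leibniz, smul_eq_mul, Finset.sum_add_distrib, mul_sub, mul_add,
          Finset.mul_sum]
        simp only [← Finset.sum_sub_distrib, ← Finset.sum_add_distrib]
        exact Finset.sum_congr rfl fun l _ => by ring }
  map_add' a b := by
    ext A i k : 3
    change (a + b).coeff * D (A.1 i k) = a.coeff * D (A.1 i k) + b.coeff * D (A.1 i k)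
    rw [map_add, add_mul]
  map_smul' c a := by
    ext A i k : 3
    change (c • a).coeff * D (A.1 i k) = c • (a.coeff * D (A.1 i k))
    rw [map_smul, Algebra.smul_mul_assoc]
  map_lie' {a b} := by
    ext A i k : 3
    change (Vir.coeff ⁅a, b⁆) * D (A.1 i k)
      = a.coeff * D (b.coeff * D (A.1 i k)) - b.coeff * D (a.coeff * D (A.1 i k))
    rw [Vir.coeff_lie]
    simp only [Derivation.leibniz, smul_eq_mul]
    ring

/-- The centreless Kac–Moody–Virasoro algebra of `sl(n)`: the semidirect sum of the vector fields on
the line and the current algebra of `sl(n)`. -/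
abbrev KMV (n : ℕ) : Type := LieAlgebra.SemiDirectSum (Current n) Vir (Vir.act n)

/-- The Lie algebra `L` has a (centreless) Kac–Moody–Virasoro structure with Virasoro part `𝔰` and
Kac–Moody part `𝔫`: it embeds, for some `n`, into the Kac–Moody–Virasoro algebra of `sl(n)` in such a
way that `𝔰` is mapped isomorphically onto the Virasoro algebra by the projection to it, and that
`𝔫`, which is infinite-dimensional, consists of the elements mapped into the current algebra. -/
def IsKacMoodyVirasoro {L : Type} [LieRing L] [LieAlgebra ℝ L]
    (𝔰 : LieSubalgebra ℝ L) (𝔫 : LieIdeal ℝ L) : Prop :=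
  ∃ (n : ℕ) (f : L →ₗ⁅ℝ⁆ KMV n), Function.Injective f ∧
    Function.Bijective (fun s : 𝔰 => (f s).right) ∧
    (∀ v : L, v ∈ 𝔫 ↔ (f v).right = 0) ∧
    ¬ FiniteDimensional ℝ 𝔫

/-- `L = 𝔰 ⋉ 𝔫` is a Levi decomposition: `𝔫` is a solvable ideal which is the radical of `L`, `𝔰` is a
subalgebra without nonzero solvable ideals, and `L` is the direct sum of `𝔰` and `𝔫` as a
vector space. -/
structure IsLeviDecomposition {L : Type} [LieRing L] [LieAlgebra ℝ L]
    (𝔰 : LieSubalgebra ℝ L) (𝔫 : LieIdeal ℝ L) : Prop where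
  solvable : LieAlgebra.IsSolvable 𝔫
  radical_eq : LieAlgebra.radical ℝ L = 𝔫
  semisimple : LieAlgebra.HasTrivialRadical ℝ 𝔰
  isCompl : IsCompl 𝔰.toSubmodule 𝔫.toSubmodule

end DaveyStewartson

end

/-!
After the second `x`-derivatives are eliminated by means of the system, the symmetry condition is
polynomial in the remaining jet coordinates, which are free. Splitting it with respect to them gives
determining equations in which neither `ε₂` nor `δ₂` occurs: the field is projectable, it acts on
the `(u, v)`-plane by rotations and dilations, and it is determined by six functions of time, which
are read off along the line `x = y = 0`. The compatibility of the equations for the `φ`-component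
forces `(ε₁ + δ₁) τ''' = 0`, and nothing else.

If `δ₁ = -ε₁`, the coefficient `τ` of `∂_t` is arbitrary, and sending a symmetry to `τ d/dt` maps
the symmetry algebra onto the vector fields on the line. These have no nonzero solvable ideal, and
the kernel of the map is solvable, which gives the Levi decomposition. For the embedding one
observes that, up to the transport along `∂_t`, the fields act by matrices which depend on time
only on the span of `1, x, y, xy, x² + ε₁y², x²y + (ε₁/3)y³`, `φ` and the argument of `ψ`.
-/

open scoped ContDiff

noncomputable section

namespace DaveyStewartson

/-! ### Directional derivatives -/

section DirectionalDerivative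

variable {E : Type*} [NormedAddCommGroup E] [NormedSpace ℝ E] {F G : E → ℝ}

/-- The derivative of `F` in the constant direction `v`, again as a function of the point. -/
def pd (v : E) (F : E → ℝ) : E → ℝ := fun z => fderiv ℝ F z v

theorem pd_const (v : E) (c : ℝ) : pd v (fun _ => c) = 0 := by
  funext z
  simp [pd]

theorem pd_zero (v : E) : pd v (0 : E → ℝ) = 0 := pd_const v 0

theorem pd_neg (v : E) : pd v (fun z => -F z) = fun z => -pd v F z := by
  funext z
  simp [pd, fderiv_fun_neg]

theorem pd_add (hF : Differentiable ℝ F) (hG : Differentiable ℝ G) (v : E) :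
    pd v (fun z => F z + G z) = fun z => pd v F z + pd v G z := by
  funext z
  simp [pd, fderiv_fun_add (hF z) (hG z)]

theorem pd_sub (hF : Differentiable ℝ F) (hG : Differentiable ℝ G) (v : E) :
    pd v (fun z => F z - G z) = fun z => pd v F z - pd v G z := by
  funext z
  simp [pd, fderiv_fun_sub (hF z) (hG z)]

theorem pd_mul (hF : Differentiable ℝ F) (hG : Differentiable ℝ G) (v : E) :
    pd v (fun z => F z * G z) = fun z => pd v F z * G z + F z * pd v G z := by
  funext z
  simp only [pd, fderiv_fun_mul (hF z) (hG z), add_apply, smul_apply, smul_eq_mul]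
  ring

theorem pd_div_const (hF : Differentiable ℝ F) (v : E) (c : ℝ) :
    pd v (fun z => F z / c) = fun z => pd v F z / c := by
  simp only [div_eq_mul_inv, pd_mul hF (differentiable_const _), pd_const, Pi.zero_apply, mul_zero,
    add_zero]

theorem pd_pow (hF : Differentiable ℝ F) (v : E) (n : ℕ) :
    pd v (fun z => F z ^ n) = fun z => n * F z ^ (n - 1) * pd v F z := by
  funext z
  simp [pd, fderiv_fun_pow n (hF z)]

theorem pd_of_isLinearMap [FiniteDimensional ℝ E] (hF : IsLinearMap ℝ F) (v : E) :
    pd v F = fun _ => F v := by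
  funext z
  exact DFunLike.congr_fun (hF.mk' F).toContinuousLinearMap.hasFDerivAt.fderiv v

@[fun_prop]
theorem contDiff_pd (v : E) (hF : ContDiff ℝ ∞ F) : ContDiff ℝ ∞ (pd v F) :=
  (hF.fderiv_right (by simp)).clm_apply contDiff_const

theorem pd_pd_apply (hF : ContDiff ℝ ∞ F) (v w z : E) :
    pd v (pd w F) z = fderiv ℝ (fderiv ℝ F) z v w := by
  have hF' : ContDiff ℝ ∞ (fderiv ℝ F) := hF.fderiv_right (by simp)
  change fderiv ℝ (fun y => fderiv ℝ F y w) z v = _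
  simp [fderiv_clm_apply (hF'.differentiable (by simp) z) (differentiableAt_const w)]

theorem pd_comm (hF : ContDiff ℝ ∞ F) (v w : E) : pd v (pd w F) = pd w (pd v F) := by
  funext z
  rw [pd_pd_apply hF, pd_pd_apply hF]
  refine (hF.contDiffAt.isSymmSndFDerivAt ?_).eq v w
  rw [minSmoothness_of_isRCLikeNormedField]
  exact WithTop.coe_le_coe.2 le_top

end DirectionalDerivative

/-! ### Functions of time and coefficients of vector fields -/

attribute [fun_prop] C.contDiff C.differentiable

@[ext] theorem C.ext {f g : C} (h : ∀ t, f.1 t = g.1 t) : f = g := Subtype.ext (funext h)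

@[simp] theorem C.add_apply (f g : C) (t : ℝ) : (f + g).1 t = f.1 t + g.1 t := rfl

@[simp] theorem C.sub_apply (f g : C) (t : ℝ) : (f - g).1 t = f.1 t - g.1 t := rfl

@[simp] theorem C.mul_apply (f g : C) (t : ℝ) : (f * g).1 t = f.1 t * g.1 t := rfl

@[simp] theorem C.smul_apply (c : ℝ) (f : C) (t : ℝ) : (c • f).1 t = c * f.1 t := rfl

@[simp] theorem C.zero_apply (t : ℝ) : (0 : C).1 t = 0 := rfl

@[simp] theorem C.one_apply (t : ℝ) : (1 : C).1 t = 1 := rfl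

theorem C.hasDerivAt (f : C) (t : ℝ) : HasDerivAt f.1 ((D f).1 t) t :=
  (f.differentiable t).hasDerivAt

theorem D_mul (f g : C) : D (f * g) = f * D g + D f * g := by
  rw [Derivation.leibniz, smul_eq_mul, smul_eq_mul, mul_comm g]

theorem pd_fst (v : J0) (i : Fin 3) : pd v (fun z => z.1 i) = fun _ => v.1 i :=
  pd_of_isLinearMap ⟨fun _ _ => rfl, fun _ _ => rfl⟩ v

theorem pd_snd (v : J0) (a : Fin 3) : pd v (fun z => z.2 a) = fun _ => v.2 a :=
  pd_of_isLinearMap ⟨fun _ _ => rfl, fun _ _ => rfl⟩ v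

theorem pd_time (v : J0) (f : C) :
    pd v (fun z => f.1 (z.1 0)) = fun z => (D f).1 (z.1 0) * v.1 0 := by
  funext z
  have ht : DifferentiableAt ℝ (fun z : J0 => z.1 0) z := by fun_prop
  have h := ((f.hasDerivAt (z.1 0)).comp_hasFDerivAt z ht.hasFDerivAt).fderiv
  exact (DFunLike.congr_fun h v).trans
    (congrArg ((D f).1 (z.1 0) * ·) (congrFun (pd_fst v 0) z))

/-- The coefficients `ξ⁰, ξ¹, ξ²` of a vector field at `∂_t, ∂_x, ∂_y`. -/
def xi (V : VF) (k : Fin 3) : J0 → ℝ := fun z => (V.1 z).1 k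

/-- The coefficients `η⁰, η¹, η²` of a vector field at `∂_u, ∂_v, ∂_φ`. -/
def eta (V : VF) (a : Fin 3) : J0 → ℝ := fun z => (V.1 z).2 a

@[fun_prop]
theorem contDiff_xi (V : VF) (k : Fin 3) : ContDiff ℝ ∞ (xi V k) :=
  contDiff_pi.1 (ContDiff.fst V.contDiff) k

@[fun_prop]
theorem contDiff_eta (V : VF) (a : Fin 3) : ContDiff ℝ ∞ (eta V a) :=
  contDiff_pi.1 (ContDiff.snd V.contDiff) a

theorem VF.ext_xi_eta {V V' : VF} (hξ : xi V = xi V') (hη : eta V = eta V') : V = V' := by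
  ext1; funext z
  exact Prod.ext (funext fun k => congrFun (congrFun hξ k) z)
    (funext fun a => congrFun (congrFun hη a) z)

theorem pd_xi (V : VF) (k : Fin 3) (v z : J0) : pd v (xi V k) z = (fderiv ℝ V.1 z v).1 k :=
  DFunLike.congr_fun (hasFDerivAt_pi'.1 (V.differentiable z).hasFDerivAt.fst k).fderiv v

theorem pd_eta (V : VF) (a : Fin 3) (v z : J0) : pd v (eta V a) z = (fderiv ℝ V.1 z v).2 a :=
  DFunLike.congr_fun (hasFDerivAt_pi'.1 (V.differentiable z).hasFDerivAt.snd a).fderiv v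

theorem xi_lie (V V' : VF) (k : Fin 3) (z : J0) :
    xi ⁅V, V'⁆ k z = pd (V.1 z) (xi V' k) z - pd (V'.1 z) (xi V k) z := by
  rw [pd_xi, pd_xi]
  rfl

theorem eta_lie (V V' : VF) (a : Fin 3) (z : J0) :
    eta ⁅V, V'⁆ a z = pd (V.1 z) (eta V' a) z - pd (V'.1 z) (eta V a) z := by
  rw [pd_eta, pd_eta]
  rfl

/-! ### The general element -/

/-- The parameters `(τ, α, β, μ, γ, δ)` of the general element. -/
abbrev Coeffs : Type := C × C × C × C × C × C

/-- The coefficient of `v ∂_u - u ∂_v` in the general element. -/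
def phase (ε₁ : ℝ) : Coeffs → J0 → ℝ := fun (τ, α, β, μ, _, _) z =>
  μ.1 (z.1 0) - (z.1 1 ^ 2 + ε₁ * z.1 2 ^ 2) / 8 * (D (D τ)).1 (z.1 0)
    - z.1 1 / 2 * (D α).1 (z.1 0) - z.1 2 / (2 * ε₁) * (D β).1 (z.1 0)

/-- The part of the coefficient of `∂_φ` in the general element that does not depend on `φ`. -/
def shift (ε₁ δ₁ : ℝ) : Coeffs → J0 → ℝ := fun (τ, α, β, μ, γ, δ) z =>
  -((D (D (D τ))).1 (z.1 0) / 8 * (z.1 1 ^ 2 * z.1 2 + ε₁ / 3 * z.1 2 ^ 3))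
    - z.1 1 * z.1 2 / 2 * (D (D α)).1 (z.1 0)
    + (D (D β)).1 (z.1 0) / (4 * ε₁) * (δ₁ * z.1 1 ^ 2 - z.1 2 ^ 2)
    + z.1 2 * (D μ).1 (z.1 0) + z.1 1 * γ.1 (z.1 0) + δ.1 (z.1 0)

theorem sum_generators_apply (ε₁ δ₁ : ℝ) (τ α β μ γ δ : C) (z : J0) :
    (X ε₁ τ + Y α + Z ε₁ δ₁ β + W μ + R γ + S δ).1 z =
      (![τ.1 (z.1 0), (D τ).1 (z.1 0) / 2 * z.1 1 + α.1 (z.1 0),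
          (D τ).1 (z.1 0) / 2 * z.1 2 + β.1 (z.1 0)],
        ![-((D τ).1 (z.1 0) / 2 * z.2 0) + phase ε₁ (τ, α, β, μ, γ, δ) z * z.2 1,
          -((D τ).1 (z.1 0) / 2 * z.2 1) - phase ε₁ (τ, α, β, μ, γ, δ) z * z.2 0,
          -((D τ).1 (z.1 0) / 2 * z.2 2) + shift ε₁ δ₁ (τ, α, β, μ, γ, δ) z]) := by
  change (X ε₁ τ).1 z + (Y α).1 z + (Z ε₁ δ₁ β).1 z + (W μ).1 z + (R γ).1 z + (S δ).1 z = _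
  ext i <;> fin_cases i <;> simp [X, Y, Z, W, R, S, phase, shift] <;> ring

/-- The general element `X(τ) + Y(α) + Z(β) + W(μ) + R(γ) + S(δ)`. -/
def generalField (ε₁ δ₁ : ℝ) : Coeffs →ₗ[ℝ] VF where
  toFun := fun (τ, α, β, μ, γ, δ) => X ε₁ τ + Y α + Z ε₁ δ₁ β + W μ + R γ + S δ
  map_add' := by
    rintro ⟨τ, α, β, μ, γ, δ⟩ ⟨τ', α', β', μ', γ', δ'⟩
    ext1; funext z
    refine (sum_generators_apply ..).trans (.trans ?_ (congrArg₂ (· + ·)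
      (sum_generators_apply ε₁ δ₁ τ α β μ γ δ z) (sum_generators_apply ..)).symm)
    ext i <;> fin_cases i <;> simp [phase, shift] <;> ring
  map_smul' := by
    rintro c ⟨τ, α, β, μ, γ, δ⟩
    ext1; funext z
    refine (sum_generators_apply ..).trans (.trans ?_ (congrArg (c • ·)
      (sum_generators_apply ε₁ δ₁ τ α β μ γ δ z)).symm)
    ext i <;> fin_cases i <;> simp [phase, shift] <;> ring

theorem generalField_apply (ε₁ δ₁ : ℝ) (τ α β μ γ δ : C) :
    generalField ε₁ δ₁ (τ, α, β, μ, γ, δ) = X ε₁ τ + Y α + Z ε₁ δ₁ β + W μ + R γ + S δ :=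
  rfl

theorem xi_generalField (ε₁ δ₁ : ℝ) (τ α β μ γ δ : C) :
    xi (generalField ε₁ δ₁ (τ, α, β, μ, γ, δ)) =
      ![fun z => τ.1 (z.1 0), fun z => (D τ).1 (z.1 0) / 2 * z.1 1 + α.1 (z.1 0),
        fun z => (D τ).1 (z.1 0) / 2 * z.1 2 + β.1 (z.1 0)] := by
  funext k z
  refine (congrArg (·.1 k) (sum_generators_apply ε₁ δ₁ τ α β μ γ δ z)).trans ?_
  fin_cases k <;> rfl

theorem eta_generalField (ε₁ δ₁ : ℝ) (τ α β μ γ δ : C) :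
    eta (generalField ε₁ δ₁ (τ, α, β, μ, γ, δ)) =
      ![fun z => -((D τ).1 (z.1 0) / 2 * z.2 0) + phase ε₁ (τ, α, β, μ, γ, δ) z * z.2 1,
        fun z => -((D τ).1 (z.1 0) / 2 * z.2 1) - phase ε₁ (τ, α, β, μ, γ, δ) z * z.2 0,
        fun z => -((D τ).1 (z.1 0) / 2 * z.2 2) + shift ε₁ δ₁ (τ, α, β, μ, γ, δ) z] := by
  funext a z
  refine (congrArg (·.2 a) (sum_generators_apply ε₁ δ₁ τ α β μ γ δ z)).trans ?_
  fin_cases a <;> rfl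

@[fun_prop]
theorem differentiable_phase (ε₁ : ℝ) (c : Coeffs) : Differentiable ℝ (phase ε₁ c) := by
  unfold phase
  fun_prop

@[fun_prop]
theorem differentiable_shift (ε₁ δ₁ : ℝ) (c : Coeffs) :
    Differentiable ℝ (shift ε₁ δ₁ c) := by
  unfold shift
  fun_prop

theorem pd_phase (ε₁ : ℝ) (τ α β μ γ δ : C) (v : J0) :
    pd v (phase ε₁ (τ, α, β, μ, γ, δ)) = fun z =>
      phase ε₁ (D τ, D α, D β, D μ, D γ, D δ) z * v.1 0
        - (z.1 1 / 4 * (D (D τ)).1 (z.1 0) + (D α).1 (z.1 0) / 2) * v.1 1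
        - (ε₁ * z.1 2 / 4 * (D (D τ)).1 (z.1 0) + (D β).1 (z.1 0) / (2 * ε₁)) * v.1 2 := by
  unfold phase
  simp (disch := fun_prop) only [pd_add, pd_sub, pd_mul, pd_div_const, pd_pow, pd_const, pd_fst,
    pd_time]
  funext z
  simp only [Pi.zero_apply, Nat.cast_ofNat, Nat.add_one_sub_one, pow_one]
  ring

theorem pd_shift (ε₁ δ₁ : ℝ) (τ α β μ γ δ : C) (v : J0) :
    pd v (shift ε₁ δ₁ (τ, α, β, μ, γ, δ)) = fun z =>
      shift ε₁ δ₁ (D τ, D α, D β, D μ, D γ, D δ) z * v.1 0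
        + (-(z.1 1 * z.1 2 / 4 * (D (D (D τ))).1 (z.1 0)) - z.1 2 / 2 * (D (D α)).1 (z.1 0)
          + δ₁ * z.1 1 / (2 * ε₁) * (D (D β)).1 (z.1 0) + γ.1 (z.1 0)) * v.1 1
        + phase ε₁ (D τ, D α, D β, D μ, D γ, D δ) z * v.1 2 := by
  unfold shift phase
  simp (disch := fun_prop) only [pd_add, pd_sub, pd_neg, pd_mul, pd_div_const, pd_pow, pd_const,
    pd_fst, pd_time]
  funext z
  simp only [Pi.zero_apply, Nat.cast_ofNat, Nat.add_one_sub_one, pow_one]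
  ring

theorem pd_xi_generalField (ε₁ δ₁ : ℝ) (τ α β μ γ δ : C) (v z : J0) :
    (fun k => pd v (xi (generalField ε₁ δ₁ (τ, α, β, μ, γ, δ)) k) z) =
      ![(D τ).1 (z.1 0) * v.1 0,
        ((D (D τ)).1 (z.1 0) / 2 * z.1 1 + (D α).1 (z.1 0)) * v.1 0
          + (D τ).1 (z.1 0) / 2 * v.1 1,
        ((D (D τ)).1 (z.1 0) / 2 * z.1 2 + (D β).1 (z.1 0)) * v.1 0
          + (D τ).1 (z.1 0) / 2 * v.1 2] := by
  rw [xi_generalField]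
  funext k
  fin_cases k <;>
    simp (disch := fun_prop) [pd_add, pd_mul, pd_div_const, pd_time, pd_fst] <;> ring

theorem pd_eta_generalField (ε₁ δ₁ : ℝ) (τ α β μ γ δ : C) (v z : J0) :
    (fun a => pd v (eta (generalField ε₁ δ₁ (τ, α, β, μ, γ, δ)) a) z) =
      ![-((D (D τ)).1 (z.1 0) * v.1 0 / 2 * z.2 0) - (D τ).1 (z.1 0) / 2 * v.2 0
          + pd v (phase ε₁ (τ, α, β, μ, γ, δ)) z * z.2 1 + phase ε₁ (τ, α, β, μ, γ, δ) z * v.2 1,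
        -((D (D τ)).1 (z.1 0) * v.1 0 / 2 * z.2 1) - (D τ).1 (z.1 0) / 2 * v.2 1
          - pd v (phase ε₁ (τ, α, β, μ, γ, δ)) z * z.2 0 - phase ε₁ (τ, α, β, μ, γ, δ) z * v.2 0,
        -((D (D τ)).1 (z.1 0) * v.1 0 / 2 * z.2 2) - (D τ).1 (z.1 0) / 2 * v.2 2
          + pd v (shift ε₁ δ₁ (τ, α, β, μ, γ, δ)) z] := by
  rw [eta_generalField]
  funext a
  fin_cases a <;>
    simp (disch := fun_prop) [pd_add, pd_sub, pd_neg, pd_mul, pd_div_const, pd_time, pd_snd] <;>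
    ring

/-- The commutator of two general elements, in terms of their parameters. -/
def lieCoeffs (ε₁ δ₁ : ℝ) : Coeffs → Coeffs → Coeffs :=
  fun (τ, α, β, μ, γ, δ) (τ', α', β', μ', γ', δ') =>
    (τ * D τ' - D τ * τ',
      τ * D α' - (1 / 2 : ℝ) • (D τ * α') - (τ' * D α - (1 / 2 : ℝ) • (D τ' * α)),
      τ * D β' - (1 / 2 : ℝ) • (D τ * β') - (τ' * D β - (1 / 2 : ℝ) • (D τ' * β)),
      τ * D μ' - τ' * D μ - (1 / 2 : ℝ) • (α * D α' - D α * α')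
        - (ε₁ / 2) • (β * D β' - D β * β'),
      τ * D γ' + D τ * γ' - (τ' * D γ + D τ' * γ)
        + (1 / 2 : ℝ) • (D (D α) * β' + (δ₁ * ε₁) • (α * D (D β')))
        - (1 / 2 : ℝ) • (D (D α') * β + (δ₁ * ε₁) • (α' * D (D β))),
      τ * D δ' + (1 / 2 : ℝ) • (D τ * δ') - (τ' * D δ + (1 / 2 : ℝ) • (D τ' * δ))
        + (α * γ' - α' * γ) + (β * D μ' - β' * D μ))

theorem phase_lieCoeffs {ε₁ : ℝ} (hε₁ : ε₁ = 1 ∨ ε₁ = -1) (δ₁ : ℝ) (c c' : Coeffs) (z : J0) :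
    phase ε₁ (lieCoeffs ε₁ δ₁ c c') z =
      pd ((generalField ε₁ δ₁ c).1 z) (phase ε₁ c') z
        - pd ((generalField ε₁ δ₁ c').1 z) (phase ε₁ c) z := by
  obtain ⟨⟨τ, α, β, μ, γ, δ⟩, ⟨τ', α', β', μ', γ', δ'⟩⟩ := c, c'
  simp only [pd_phase, generalField_apply, sum_generators_apply, Matrix.cons_val, lieCoeffs, phase,
    map_add, map_sub, D_mul, D.map_smul, C.add_apply, C.sub_apply, C.mul_apply, C.smul_apply]
  rcases hε₁ with rfl | rfl <;> ring

theorem shift_lieCoeffs {ε₁ δ₁ : ℝ} (hε₁ : ε₁ = 1 ∨ ε₁ = -1)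
    {τ α β μ γ δ τ' α' β' μ' γ' δ' : C}
    (h : (ε₁ + δ₁) • (D (D (D τ)) * β' - D (D (D τ')) * β) = 0) (z : J0) :
    shift ε₁ δ₁ (lieCoeffs ε₁ δ₁ (τ, α, β, μ, γ, δ) (τ', α', β', μ', γ', δ')) z =
      pd ((generalField ε₁ δ₁ (τ, α, β, μ, γ, δ)).1 z) (shift ε₁ δ₁ (τ', α', β', μ', γ', δ')) z
          + (D τ).1 (z.1 0) / 2 * shift ε₁ δ₁ (τ', α', β', μ', γ', δ') z
        - (pd ((generalField ε₁ δ₁ (τ', α', β', μ', γ', δ')).1 z)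
            (shift ε₁ δ₁ (τ, α, β, μ, γ, δ)) z
          + (D τ').1 (z.1 0) / 2 * shift ε₁ δ₁ (τ, α, β, μ, γ, δ) z) := by
  have hz := congrArg (·.1 (z.1 0)) h
  simp only [C.smul_apply, C.sub_apply, C.mul_apply, C.zero_apply] at hz
  simp only [pd_shift, generalField_apply, sum_generators_apply, Matrix.cons_val, lieCoeffs, shift,
    phase, map_add, map_sub, D_mul, D.map_smul, C.add_apply, C.sub_apply, C.mul_apply, C.smul_apply]
  rcases hε₁ with rfl | rfl
  · linear_combination -(z.1 1 ^ 2 / 8) * hz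
  · linear_combination z.1 1 ^ 2 / 8 * hz

theorem lie_generalField {ε₁ δ₁ : ℝ} (hε₁ : ε₁ = 1 ∨ ε₁ = -1)
    {τ α β μ γ δ τ' α' β' μ' γ' δ' : C}
    (h : (ε₁ + δ₁) • (D (D (D τ)) * β' - D (D (D τ')) * β) = 0) :
    ⁅generalField ε₁ δ₁ (τ, α, β, μ, γ, δ), generalField ε₁ δ₁ (τ', α', β', μ', γ', δ')⁆ =
      generalField ε₁ δ₁ (lieCoeffs ε₁ δ₁ (τ, α, β, μ, γ, δ) (τ', α', β', μ', γ', δ')) := by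
  have hphase := phase_lieCoeffs hε₁ δ₁ (τ, α, β, μ, γ, δ) (τ', α', β', μ', γ', δ')
  have hshift := shift_lieCoeffs hε₁ h (α := α) (μ := μ) (γ := γ) (δ := δ) (α' := α') (μ' := μ')
    (γ' := γ') (δ' := δ')
  refine VF.ext_xi_eta ?_ ?_ <;> funext i z
  · rw [lieCoeffs, xi_generalField, xi_lie, congrFun (pd_xi_generalField ..) i,
      congrFun (pd_xi_generalField ..) i, generalField_apply, generalField_apply,
      sum_generators_apply, sum_generators_apply]
    fin_cases i <;> simp <;> ring
  · rw [lieCoeffs] at hphase hshift ⊢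
    rw [eta_generalField, eta_lie, congrFun (pd_eta_generalField ..) i,
      congrFun (pd_eta_generalField ..) i]
    fin_cases i <;>
    · simp only [Fin.zero_eta, Fin.mk_one, Fin.reduceFinMk, Matrix.cons_val, hphase, hshift]
      simp only [generalField_apply, sum_generators_apply, D_mul, map_sub, Matrix.cons_val,
        C.sub_apply, C.mul_apply, C.add_apply]
      ring

theorem X_eq_generalField (ε₁ δ₁ : ℝ) (τ : C) :
    X ε₁ τ = generalField ε₁ δ₁ (τ, 0, 0, 0, 0, 0) := by
  ext1; funext z
  refine .trans ?_ (sum_generators_apply ..).symm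
  ext i <;> fin_cases i <;> simp [X, phase, shift] <;> ring

theorem Y_eq_generalField (ε₁ δ₁ : ℝ) (α : C) :
    Y α = generalField ε₁ δ₁ (0, α, 0, 0, 0, 0) := by
  ext1; funext z
  refine .trans ?_ (sum_generators_apply ..).symm
  ext i <;> fin_cases i <;> simp [Y, phase, shift]

theorem Z_eq_generalField (ε₁ δ₁ : ℝ) (β : C) :
    Z ε₁ δ₁ β = generalField ε₁ δ₁ (0, 0, β, 0, 0, 0) := by
  ext1; funext z
  refine .trans ?_ (sum_generators_apply ..).symm
  ext i <;> fin_cases i <;> simp [Z, phase, shift]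

theorem W_eq_generalField (ε₁ δ₁ : ℝ) (μ : C) :
    W μ = generalField ε₁ δ₁ (0, 0, 0, μ, 0, 0) := by
  ext1; funext z
  refine .trans ?_ (sum_generators_apply ..).symm
  ext i <;> fin_cases i <;> simp [W, phase, shift]

theorem R_eq_generalField (ε₁ δ₁ : ℝ) (γ : C) :
    R γ = generalField ε₁ δ₁ (0, 0, 0, 0, γ, 0) := by
  ext1; funext z
  refine .trans ?_ (sum_generators_apply ..).symm
  ext i <;> fin_cases i <;> simp [R, phase, shift]

theorem S_eq_generalField (ε₁ δ₁ : ℝ) (δ : C) :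
    S δ = generalField ε₁ δ₁ (0, 0, 0, 0, 0, δ) := by
  ext1; funext z
  refine .trans ?_ (sum_generators_apply ..).symm
  ext i <;> fin_cases i <;> simp [S, phase, shift]

section Commutators

variable {ε₁ : ℝ} (hε₁ : ε₁ = 1 ∨ ε₁ = -1) (δ₁ : ℝ)
include hε₁

theorem lie_X_X (τ τ' : C) : ⁅X ε₁ τ, X ε₁ τ'⁆ = X ε₁ (τ * D τ' - D τ * τ') := by
  rw [X_eq_generalField ε₁ 0, X_eq_generalField ε₁ 0, X_eq_generalField ε₁ 0,
    lie_generalField hε₁ (by simp)]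
  simp [lieCoeffs]

theorem lie_X_Y (τ α : C) : ⁅X ε₁ τ, Y α⁆ = Y (τ * D α - (1 / 2 : ℝ) • (D τ * α)) := by
  rw [X_eq_generalField ε₁ 0, Y_eq_generalField ε₁ 0, Y_eq_generalField ε₁ 0,
    lie_generalField hε₁ (by simp)]
  simp [lieCoeffs]

theorem lie_X_Z {τ : C} (h : (ε₁ + δ₁) • D (D (D τ)) = 0) (β : C) :
    ⁅X ε₁ τ, Z ε₁ δ₁ β⁆ = Z ε₁ δ₁ (τ * D β - (1 / 2 : ℝ) • (D τ * β)) := by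
  rw [X_eq_generalField ε₁ δ₁, Z_eq_generalField ε₁ δ₁, Z_eq_generalField ε₁ δ₁,
    lie_generalField hε₁ (by simp [← smul_mul_assoc, h])]
  simp [lieCoeffs]

theorem lie_X_W (τ μ : C) : ⁅X ε₁ τ, W μ⁆ = W (τ * D μ) := by
  rw [X_eq_generalField ε₁ 0, W_eq_generalField ε₁ 0, W_eq_generalField ε₁ 0,
    lie_generalField hε₁ (by simp)]
  simp [lieCoeffs]

theorem lie_X_R (τ γ : C) : ⁅X ε₁ τ, R γ⁆ = R (τ * D γ + D τ * γ) := by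
  rw [X_eq_generalField ε₁ 0, R_eq_generalField ε₁ 0, R_eq_generalField ε₁ 0,
    lie_generalField hε₁ (by simp)]
  simp [lieCoeffs]

theorem lie_X_S (τ δ : C) : ⁅X ε₁ τ, S δ⁆ = S (τ * D δ + (1 / 2 : ℝ) • (D τ * δ)) := by
  rw [X_eq_generalField ε₁ 0, S_eq_generalField ε₁ 0, S_eq_generalField ε₁ 0,
    lie_generalField hε₁ (by simp)]
  simp [lieCoeffs]

theorem lie_Z_Z (β β' : C) : ⁅Z ε₁ δ₁ β, Z ε₁ δ₁ β'⁆ = -(ε₁ / 2) • W (β * D β' - D β * β') := by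
  rw [Z_eq_generalField ε₁ δ₁, Z_eq_generalField ε₁ δ₁, W_eq_generalField ε₁ δ₁,
    lie_generalField hε₁ (by simp), ← map_smul]
  simp [lieCoeffs]

theorem lie_Y_Z (α β : C) :
    ⁅Y α, Z ε₁ δ₁ β⁆ = (1 / 2 : ℝ) • R (D (D α) * β + (δ₁ * ε₁) • (α * D (D β))) := by
  rw [Y_eq_generalField ε₁ δ₁, Z_eq_generalField ε₁ δ₁, R_eq_generalField ε₁ δ₁,
    lie_generalField hε₁ (by simp), ← map_smul]
  simp [lieCoeffs]

theorem lie_Z_W (β μ : C) : ⁅Z ε₁ δ₁ β, W μ⁆ = S (β * D μ) := by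
  rw [Z_eq_generalField ε₁ δ₁, W_eq_generalField ε₁ δ₁, S_eq_generalField ε₁ δ₁,
    lie_generalField hε₁ (by simp)]
  simp [lieCoeffs]

theorem lie_Z_R (f g : C) : ⁅Z ε₁ δ₁ f, R g⁆ = 0 := by
  rw [Z_eq_generalField ε₁ δ₁, R_eq_generalField ε₁ δ₁, lie_generalField hε₁ (by simp)]
  simp [lieCoeffs, ← Prod.zero_eq_mk]

theorem lie_Z_S (f g : C) : ⁅Z ε₁ δ₁ f, S g⁆ = 0 := by
  rw [Z_eq_generalField ε₁ δ₁, S_eq_generalField ε₁ δ₁, lie_generalField hε₁ (by simp)]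
  simp [lieCoeffs, ← Prod.zero_eq_mk]

end Commutators

theorem lie_Y_Y (α α' : C) : ⁅Y α, Y α'⁆ = -(1 / 2 : ℝ) • W (α * D α' - D α * α') := by
  rw [Y_eq_generalField 1 0, Y_eq_generalField 1 0, W_eq_generalField 1 0,
    lie_generalField (.inl rfl) (by simp), ← map_smul]
  simp [lieCoeffs]

theorem lie_Y_R (α γ : C) : ⁅Y α, R γ⁆ = S (α * γ) := by
  rw [Y_eq_generalField 1 0, R_eq_generalField 1 0, S_eq_generalField 1 0,
    lie_generalField (.inl rfl) (by simp)]
  simp [lieCoeffs]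

theorem lie_Y_W (f g : C) : ⁅Y f, W g⁆ = 0 := by
  rw [Y_eq_generalField 1 0, W_eq_generalField 1 0, lie_generalField (.inl rfl) (by simp)]
  simp [lieCoeffs, ← Prod.zero_eq_mk]

theorem lie_Y_S (f g : C) : ⁅Y f, S g⁆ = 0 := by
  rw [Y_eq_generalField 1 0, S_eq_generalField 1 0, lie_generalField (.inl rfl) (by simp)]
  simp [lieCoeffs, ← Prod.zero_eq_mk]

theorem lie_W_W (f g : C) : ⁅W f, W g⁆ = 0 := by
  rw [W_eq_generalField 1 0, W_eq_generalField 1 0, lie_generalField (.inl rfl) (by simp)]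
  simp [lieCoeffs, ← Prod.zero_eq_mk]

theorem lie_W_R (f g : C) : ⁅W f, R g⁆ = 0 := by
  rw [W_eq_generalField 1 0, R_eq_generalField 1 0, lie_generalField (.inl rfl) (by simp)]
  simp [lieCoeffs, ← Prod.zero_eq_mk]

theorem lie_W_S (f g : C) : ⁅W f, S g⁆ = 0 := by
  rw [W_eq_generalField 1 0, S_eq_generalField 1 0, lie_generalField (.inl rfl) (by simp)]
  simp [lieCoeffs, ← Prod.zero_eq_mk]

theorem lie_R_R (f g : C) : ⁅R f, R g⁆ = 0 := by
  rw [R_eq_generalField 1 0, R_eq_generalField 1 0, lie_generalField (.inl rfl) (by simp)]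
  simp [lieCoeffs, ← Prod.zero_eq_mk]

theorem lie_R_S (f g : C) : ⁅R f, S g⁆ = 0 := by
  rw [R_eq_generalField 1 0, S_eq_generalField 1 0, lie_generalField (.inl rfl) (by simp)]
  simp [lieCoeffs, ← Prod.zero_eq_mk]

theorem lie_S_S (f g : C) : ⁅S f, S g⁆ = 0 := by
  rw [S_eq_generalField 1 0, S_eq_generalField 1 0, lie_generalField (.inl rfl) (by simp)]
  simp [lieCoeffs, ← Prod.zero_eq_mk]

/-! ### The prolongation in terms of directional derivatives -/

/-- The coordinate vectors `∂_t, ∂_x, ∂_y` of the space of variables. -/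
def baseDir (i : Fin 3) : J0 := (Pi.single i 1, 0)

/-- The coordinate vectors `∂_u, ∂_v, ∂_φ` of the space of variables. -/
def fibreDir (a : Fin 3) : J0 := (0, Pi.single a 1)

@[simp] theorem baseDir_fst (i k : Fin 3) : (baseDir i).1 k = if k = i then 1 else 0 :=
  Pi.single_apply i 1 k

@[simp] theorem baseDir_snd (i : Fin 3) : (baseDir i).2 = 0 := rfl

@[simp] theorem fibreDir_fst (a : Fin 3) : (fibreDir a).1 = 0 := rfl

@[simp] theorem fibreDir_snd (a b : Fin 3) : (fibreDir a).2 b = if b = a then 1 else 0 :=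
  Pi.single_apply a 1 b

local notation "∂t" => pd (baseDir 0)
local notation "∂x" => pd (baseDir 1)
local notation "∂y" => pd (baseDir 2)
local notation "∂u" => pd (fibreDir 0)
local notation "∂v" => pd (fibreDir 1)
local notation "∂φ" => pd (fibreDir 2)

theorem pd_eq_sum (v : J0) (F : J0 → ℝ) (z : J0) :
    pd v F z = ∑ i, v.1 i * pd (baseDir i) F z + ∑ a, v.2 a * pd (fibreDir a) F z := by
  have hv : v = ∑ i, v.1 i • baseDir i + ∑ a, v.2 a • fibreDir a := by
    ext i <;> fin_cases i <;> simp [baseDir, fibreDir, Fin.sum_univ_three]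
  nth_rewrite 1 [hv]
  simp only [pd, map_add, map_sum, map_smul, smul_eq_mul]

/-- The direction in which a function of the variables is differentiated by the total derivative
`Dᵢ` at a jet with first derivatives `p`. -/
def lift (p : Fin 3 → Fin 3 → ℝ) (i : Fin 3) : J0 := (Pi.single i 1, fun a => p a i)

theorem pd_lift (p : Fin 3 → Fin 3 → ℝ) (i : Fin 3) (F : J0 → ℝ) (z : J0) :
    pd (lift p i) F z = pd (baseDir i) F z + ∑ a, p a i * pd (fibreDir a) F z := by
  rw [pd_eq_sum]
  simp [lift, Pi.single_apply]

theorem pd_vertical (w : Fin 3 → ℝ) (F : J0 → ℝ) (z : J0) :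
    pd (0, w) F z = ∑ a, w a * pd (fibreDir a) F z := by
  rw [pd_eq_sum]
  simp

/-- The coordinate `wᵃᵢ` on first-order jets, as a linear map. -/
def jetCoord (a i : Fin 3) : J1 →L[ℝ] ℝ :=
  (ContinuousLinearMap.proj (R := ℝ) (φ := fun _ : Fin 3 => ℝ) i).comp
    ((ContinuousLinearMap.proj (R := ℝ) (φ := fun _ : Fin 3 => Fin 3 → ℝ) a).comp
      (ContinuousLinearMap.snd ℝ J0 (Fin 3 → Fin 3 → ℝ)))

theorem hasFDerivAt_lift (i : Fin 3) (j : J1) :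
    HasFDerivAt (fun j : J1 => lift j.2 i)
      (ContinuousLinearMap.prod 0 (ContinuousLinearMap.pi fun a => jetCoord a i)) j :=
  (hasFDerivAt_const (Pi.single i 1) j).prodMk
    (ContinuousLinearMap.pi fun a => jetCoord a i).hasFDerivAt

@[fun_prop]
theorem contDiff_totalD0 {F : J0 → ℝ} (hF : ContDiff ℝ ∞ F) (i : Fin 3) :
    ContDiff ℝ ∞ (totalD0 F i) := by
  have : ContDiff ℝ ∞ (fderiv ℝ F) := hF.fderiv_right (by simp)
  unfold totalD0
  fun_prop

theorem totalD1_totalD0 {F : J0 → ℝ} (hF : ContDiff ℝ ∞ F) (i : Fin 3) (j : J2) :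
    totalD1 (totalD0 F i) i j = pd (lift j.1.2 i) (pd (lift j.1.2 i) F) j.1.1
      + pd (0, fun a => j.2 a i i) F j.1.1 := by
  have hF' : ContDiff ℝ ∞ (fderiv ℝ F) := hF.fderiv_right (by simp)
  have h := ((hF'.differentiable (by simp) j.1.1).hasFDerivAt.comp j.1
    (hasFDerivAt_fst (p := j.1))).clm_apply (hasFDerivAt_lift i j.1)
  rw [pd_pd_apply hF]
  exact (DFunLike.congr_fun h.fderiv _).trans (add_comm _ _)

theorem totalD1_prol1 (V : VF) (a i : Fin 3) (j : J2) :
    totalD1 (prol1 V.1 a i) i j = totalD1 (totalD0 (eta V a) i) i j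
      - ∑ k, (totalD1 (totalD0 (xi V k) i) i j * j.1.2 a k
        + totalD0 (xi V k) i j.1 * j.2 a k i) := by
  have hη := ((contDiff_totalD0 (contDiff_eta V a) i).differentiable (by simp) j.1).hasFDerivAt
  have hξ (k) := ((contDiff_totalD0 (contDiff_xi V k) i).differentiable (by simp) j.1).hasFDerivAt
  have h := (hη.sub (HasFDerivAt.fun_sum (u := Finset.univ) fun k _ => (hξ k).mul
    (jetCoord a k).hasFDerivAt)).fderiv
  refine (DFunLike.congr_fun h _).trans ?_
  simp only [sub_apply, sum_apply, add_apply, smul_apply, smul_eq_mul]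
  exact congrArg _ (Finset.sum_congr rfl fun k _ => (add_comm _ _).trans
    (congrArg (· + _) (mul_comm _ _)))

theorem prol1_eq (V : VF) (a i : Fin 3) (j : J1) :
    prol1 V.1 a i j = pd (lift j.2 i) (eta V a) j.1
      - ∑ k, pd (lift j.2 i) (xi V k) j.1 * j.2 a k :=
  rfl

theorem prol2_diag (V : VF) (a i : Fin 3) {j : J2} (hj : ∀ a i k, j.2 a i k = j.2 a k i) :
    prol2 V.1 a i i j = pd (lift j.1.2 i) (pd (lift j.1.2 i) (eta V a)) j.1.1
      + pd (0, fun b => j.2 b i i) (eta V a) j.1.1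
      - ∑ k, ((pd (lift j.1.2 i) (pd (lift j.1.2 i) (xi V k)) j.1.1
          + pd (0, fun b => j.2 b i i) (xi V k) j.1.1) * j.1.2 a k
        + 2 * pd (lift j.1.2 i) (xi V k) j.1.1 * j.2 a i k) := by
  have htotal (k) : totalD0 (fun z => (V.1 z).1 k) i j.1 = pd (lift j.1.2 i) (xi V k) j.1.1 := rfl
  have htotal' (k) : totalD0 (xi V k) i j.1 = pd (lift j.1.2 i) (xi V k) j.1.1 := rfl
  rw [prol2, totalD1_prol1, totalD1_totalD0 (contDiff_eta V a), sub_sub,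
    ← Finset.sum_add_distrib]
  refine congrArg _ (Finset.sum_congr rfl fun k _ => ?_)
  rw [totalD1_totalD0 (contDiff_xi V k), hj a k i, htotal, htotal']
  ring

theorem system_eq (ε₁ ε₂ δ₁ δ₂ : ℝ) :
    system ε₁ ε₂ δ₁ δ₂ = fun j =>
      ![-j.1.2 1 0 + j.2 0 1 1 + ε₁ * j.2 0 2 2
          - ε₂ * (j.1.1.2 0 ^ 2 + j.1.1.2 1 ^ 2) * j.1.1.2 0 - j.1.1.2 0 * j.1.2 2 2,
        j.1.2 0 0 + j.2 1 1 1 + ε₁ * j.2 1 2 2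
          - ε₂ * (j.1.1.2 0 ^ 2 + j.1.1.2 1 ^ 2) * j.1.1.2 1 - j.1.1.2 1 * j.1.2 2 2,
        j.2 2 1 1 + δ₁ * j.2 2 2 2
          - δ₂ * (2 * (j.1.1.2 0 * j.1.2 0 2 + j.1.1.2 1 * j.1.2 1 2))] := by
  funext j i
  fin_cases i <;> simp [system, Complex.normSq_apply] <;> ring

theorem fderiv_system (ε₁ ε₂ δ₁ δ₂ : ℝ) (j k : J2) :
    fderiv ℝ (system ε₁ ε₂ δ₁ δ₂) j k =
      ![-k.1.2 1 0 + k.2 0 1 1 + ε₁ * k.2 0 2 2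
          - ε₂ * ((3 * j.1.1.2 0 ^ 2 + j.1.1.2 1 ^ 2) * k.1.1.2 0
            + 2 * j.1.1.2 0 * j.1.1.2 1 * k.1.1.2 1)
          - (k.1.1.2 0 * j.1.2 2 2 + j.1.1.2 0 * k.1.2 2 2),
        k.1.2 0 0 + k.2 1 1 1 + ε₁ * k.2 1 2 2
          - ε₂ * ((j.1.1.2 0 ^ 2 + 3 * j.1.1.2 1 ^ 2) * k.1.1.2 1
            + 2 * j.1.1.2 0 * j.1.1.2 1 * k.1.1.2 0)
          - (k.1.1.2 1 * j.1.2 2 2 + j.1.1.2 1 * k.1.2 2 2),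
        k.2 2 1 1 + δ₁ * k.2 2 2 2
          - 2 * δ₂ * (k.1.1.2 0 * j.1.2 0 2 + j.1.1.2 0 * k.1.2 0 2
            + k.1.1.2 1 * j.1.2 1 2 + j.1.1.2 1 * k.1.2 1 2)] := by
  have hw (a) : pd k (fun j => j.1.1.2 a) = fun _ => k.1.1.2 a :=
    pd_of_isLinearMap ⟨fun _ _ => rfl, fun _ _ => rfl⟩ k
  have hp (a i) : pd k (fun j => j.1.2 a i) = fun _ => k.1.2 a i :=
    pd_of_isLinearMap ⟨fun _ _ => rfl, fun _ _ => rfl⟩ k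
  have hq (a i l) : pd k (fun j => j.2 a i l) = fun _ => k.2 a i l :=
    pd_of_isLinearMap ⟨fun _ _ => rfl, fun _ _ => rfl⟩ k
  have hdiff : DifferentiableAt ℝ (system ε₁ ε₂ δ₁ δ₂) j := by
    rw [system_eq, differentiableAt_pi]
    intro i
    fin_cases i <;> dsimp only [Fin.zero_eta, Fin.mk_one, Fin.reduceFinMk, Matrix.cons_val] <;>
      fun_prop
  funext i
  have hi : fderiv ℝ (system ε₁ ε₂ δ₁ δ₂) j k i = pd k (fun j => system ε₁ ε₂ δ₁ δ₂ j i) j :=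
    (DFunLike.congr_fun (hasFDerivAt_pi'.1 hdiff.hasFDerivAt i).fderiv k).symm
  rw [hi, system_eq]
  fin_cases i <;>
    simp (disch := fun_prop) [pd_add, pd_sub, pd_neg, pd_mul, pd_pow, pd_const, hw, hp, hq] <;> ring

/-! ### The determining equations -/

/-- The jet over the first-order jet `(z, p)` whose second derivatives other than `∂ₓ∂ₓ` are
prescribed (`∂_t ∂_t` being zero) and whose `∂ₓ∂ₓ`-derivatives are those forced by the system. -/
def solvedJet (ε₁ ε₂ δ₁ δ₂ : ℝ) (z : J0) (p : Fin 3 → Fin 3 → ℝ) (tx ty xy yy : Fin 3 → ℝ) : J2 :=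
  let xx : Fin 3 → ℝ :=
    ![p 1 0 + ε₂ * (z.2 0 ^ 2 + z.2 1 ^ 2) * z.2 0 + z.2 0 * p 2 2 - ε₁ * yy 0,
      -p 0 0 + ε₂ * (z.2 0 ^ 2 + z.2 1 ^ 2) * z.2 1 + z.2 1 * p 2 2 - ε₁ * yy 1,
      δ₂ * (2 * (z.2 0 * p 0 2 + z.2 1 * p 1 2)) - δ₁ * yy 2]
  ((z, p), fun a => ![![0, tx a, ty a], ![tx a, xx a, xy a], ![ty a, xy a, yy a]])

theorem system_solvedJet (ε₁ ε₂ δ₁ δ₂ : ℝ) (z : J0) (p : Fin 3 → Fin 3 → ℝ)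
    (tx ty xy yy : Fin 3 → ℝ) :
    system ε₁ ε₂ δ₁ δ₂ (solvedJet ε₁ ε₂ δ₁ δ₂ z p tx ty xy yy) = 0 := by
  rw [system_eq]
  ext i
  fin_cases i <;> simp [solvedJet] <;> ring

theorem solvedJet_symm (ε₁ ε₂ δ₁ δ₂ : ℝ) (z : J0) (p : Fin 3 → Fin 3 → ℝ)
    (tx ty xy yy : Fin 3 → ℝ) : ∀ a i k, (solvedJet ε₁ ε₂ δ₁ δ₂ z p tx ty xy yy).2 a i k =
      (solvedJet ε₁ ε₂ δ₁ δ₂ z p tx ty xy yy).2 a k i := by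
  intro a i k
  fin_cases i <;> fin_cases k <;> rfl

section SymmetryCondition

variable {ε₁ ε₂ δ₁ δ₂ : ℝ} {V : VF}

theorem isSymmetry_iff : IsSymmetry ε₁ ε₂ δ₁ δ₂ V ↔
    ∀ j : J2, (∀ a i k, j.2 a i k = j.2 a k i) → system ε₁ ε₂ δ₁ δ₂ j = 0 →
      -prol1 V.1 1 0 j.1 + prol2 V.1 0 1 1 j + ε₁ * prol2 V.1 0 2 2 j
          - ε₂ * ((3 * j.1.1.2 0 ^ 2 + j.1.1.2 1 ^ 2) * eta V 0 j.1.1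
            + 2 * j.1.1.2 0 * j.1.1.2 1 * eta V 1 j.1.1)
          - (eta V 0 j.1.1 * j.1.2 2 2 + j.1.1.2 0 * prol1 V.1 2 2 j.1) = 0 ∧
        prol1 V.1 0 0 j.1 + prol2 V.1 1 1 1 j + ε₁ * prol2 V.1 1 2 2 j
          - ε₂ * ((j.1.1.2 0 ^ 2 + 3 * j.1.1.2 1 ^ 2) * eta V 1 j.1.1
            + 2 * j.1.1.2 0 * j.1.1.2 1 * eta V 0 j.1.1)
          - (eta V 1 j.1.1 * j.1.2 2 2 + j.1.1.2 1 * prol1 V.1 2 2 j.1) = 0 ∧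
        prol2 V.1 2 1 1 j + δ₁ * prol2 V.1 2 2 2 j
          - 2 * δ₂ * (eta V 0 j.1.1 * j.1.2 0 2 + j.1.1.2 0 * prol1 V.1 0 2 j.1
            + eta V 1 j.1.1 * j.1.2 1 2 + j.1.1.2 1 * prol1 V.1 1 2 j.1) = 0 := by
  refine forall₃_congr fun j _ _ => ?_
  rw [fderiv_system, funext_iff, Fin.forall_fin_succ, Fin.forall_fin_two]
  rfl

theorem IsSymmetry.pd_lift_xi (hV : IsSymmetry ε₁ ε₂ δ₁ δ₂ V) (z : J0)
    (p : Fin 3 → Fin 3 → ℝ) :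
    pd (lift p 1) (xi V 0) z = 0 ∧ ε₁ * pd (lift p 2) (xi V 0) z = 0 ∧
      pd (lift p 1) (xi V 2) z + ε₁ * pd (lift p 2) (xi V 1) z = 0 := by
  have htest (tx ty xy : Fin 3 → ℝ) := (isSymmetry_iff.1 hV _
    (solvedJet_symm ε₁ ε₂ δ₁ δ₂ z p tx ty xy 0) (system_solvedJet ..)).1
  simp only [prol2_diag V _ _ (solvedJet_symm ε₁ ε₂ δ₁ δ₂ z p _ _ _ _), Fin.sum_univ_three] at htest
  have h0 := htest 0 0 0
  have htx := htest 1 0 0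
  have hty := htest 0 1 0
  have hxy := htest 0 0 1
  simp [solvedJet] at h0 htx hty hxy
  refine ⟨?_, ?_, ?_⟩ <;> linarith

/-- The vector field `V` projects to the space of the variables `t, x, y`, and its projection
projects to the `t`-axis. -/
structure IsProjectable (V : VF) : Prop where
  pd_fibre : ∀ k a, pd (fibreDir a) (xi V k) = 0
  pd_x : ∂x (xi V 0) = 0
  pd_y : ∂y (xi V 0) = 0

theorem IsSymmetry.isProjectable (hε₁ : ε₁ ≠ 0) (hV : IsSymmetry ε₁ ε₂ δ₁ δ₂ V) :
    IsProjectable V where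
  pd_fibre k a := by
    funext z
    have h0 := hV.pd_lift_xi z 0
    have hx := hV.pd_lift_xi z fun b => ![0, Pi.single (M := fun _ => ℝ) a 1 b, 0]
    have hy := hV.pd_lift_xi z fun b => ![0, 0, Pi.single (M := fun _ => ℝ) a 1 b]
    simp [pd_lift, Pi.single_apply, hε₁] at h0 hx hy
    fin_cases k
    · simpa [h0] using hx.1
    · refine mul_left_cancel₀ hε₁ ?_
      dsimp only [Fin.mk_one, Pi.zero_apply]
      linear_combination hy.2.2 - h0.2.2
    · dsimp only [Fin.reduceFinMk, Pi.zero_apply]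
      linear_combination hx.2.2 - h0.2.2
  pd_x := funext fun z => by simpa [pd_lift] using (hV.pd_lift_xi z 0).1
  pd_y := funext fun z => by simpa [pd_lift, hε₁] using (hV.pd_lift_xi z 0).2.1

namespace IsProjectable

theorem pd_lift_xi (hV : IsProjectable V) (p : Fin 3 → Fin 3 → ℝ) (i k : Fin 3) :
    pd (lift p i) (xi V k) = pd (baseDir i) (xi V k) := by
  funext z
  simp [pd_lift, hV.pd_fibre]

theorem pd_lift_pd_xi (hV : IsProjectable V) (p : Fin 3 → Fin 3 → ℝ) (i k : Fin 3) (v : J0) :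
    pd (lift p i) (pd v (xi V k)) = pd v (pd (baseDir i) (xi V k)) := by
  rw [pd_comm (contDiff_xi V k), hV.pd_lift_xi]

theorem prol1_eq (hV : IsProjectable V) (a i : Fin 3) (j : J1) :
    prol1 V.1 a i j = pd (lift j.2 i) (eta V a) j.1
      - ∑ k, pd (baseDir i) (xi V k) j.1 * j.2 a k := by
  simp only [DaveyStewartson.prol1_eq, hV.pd_lift_xi]

theorem prol2_diag (hV : IsProjectable V) (a i : Fin 3) {j : J2}
    (hj : ∀ a i k, j.2 a i k = j.2 a k i) :
    prol2 V.1 a i i j = pd (lift j.1.2 i) (pd (lift j.1.2 i) (eta V a)) j.1.1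
      + ∑ b, j.2 b i i * pd (fibreDir b) (eta V a) j.1.1
      - ∑ k, (pd (baseDir i) (pd (baseDir i) (xi V k)) j.1.1 * j.1.2 a k
        + 2 * pd (baseDir i) (xi V k) j.1.1 * j.2 a i k) := by
  simp [DaveyStewartson.prol2_diag V a i hj, hV.pd_lift_xi, hV.pd_lift_pd_xi, pd_vertical,
    hV.pd_fibre]

end IsProjectable

theorem pd_lift_pd_lift {F : J0 → ℝ} (hF : ContDiff ℝ ∞ F) (p : Fin 3 → Fin 3 → ℝ) (i : Fin 3)
    (z : J0) :
    pd (lift p i) (pd (lift p i) F) z = pd (baseDir i) (pd (baseDir i) F) z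
      + 2 * ∑ a, p a i * pd (baseDir i) (pd (fibreDir a) F) z
      + ∑ a, p a i * ∑ b, p b i * pd (fibreDir b) (pd (fibreDir a) F) z := by
  rw [pd_lift, pd_comm hF _ (lift p i), pd_lift]
  simp only [pd_comm hF (fibreDir _) (lift p i), pd_lift, mul_add, Finset.sum_add_distrib,
    pd_comm hF (fibreDir _) (baseDir i)]
  ring

theorem IsSymmetry.pd_eta_first (hε₁ : ε₁ = 1 ∨ ε₁ = -1) (hV : IsSymmetry ε₁ ε₂ δ₁ δ₂ V) :
    ∂u (eta V 1) = -∂v (eta V 0) ∧ ∂φ (eta V 0) = 0 ∧ ∂φ (eta V 1) = 0 ∧ ∂u (eta V 2) = 0 ∧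
      ∂v (eta V 2) = 0 ∧ ∂v (eta V 1) = ∂u (eta V 0) ∧
      ∂x (xi V 1) = (fun z => ∂t (xi V 0) z / 2) ∧ ∂y (xi V 2) = fun z => ∂t (xi V 0) z / 2 := by
  have hproj := hV.isProjectable (by rcases hε₁ with rfl | rfl <;> norm_num)
  simp only [funext_iff, ← forall_and, Pi.neg_apply, Pi.zero_apply]
  intro z
  have htest (p : Fin 3 → Fin 3 → ℝ) (yy : Fin 3 → ℝ) := isSymmetry_iff.1 hV _
    (solvedJet_symm ε₁ ε₂ δ₁ δ₂ z p 0 0 0 yy) (system_solvedJet ..)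
  simp only [hproj.prol1_eq, hproj.prol2_diag _ _ (solvedJet_symm ε₁ ε₂ δ₁ δ₂ z _ _ _ _ _),
    Fin.sum_univ_three, pd_lift, pd_lift_pd_lift (contDiff_eta V _), hproj.pd_x,
    hproj.pd_y] at htest
  have h0 := htest 0 0
  have hut := htest ![![1, 0, 0], 0, 0] 0
  have hvt := htest ![0, ![1, 0, 0], 0] 0
  have hφt := htest ![0, 0, ![1, 0, 0]] 0
  have huyy := htest 0 ![1, 0, 0]
  simp [solvedJet, pd_zero] at h0 hut hvt hφt huyy
  refine ⟨?_, ?_, ?_, ?_, ?_, ?_, ?_, ?_⟩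
  · linear_combination h0.1 - hut.1
  · linear_combination hφt.2.1 - h0.2.1
  · linear_combination h0.1 - hφt.1
  · linarith [h0.2.2, hvt.2.2]
  · linarith [h0.2.2, hut.2.2]
  · linarith [h0.1, hvt.1, h0.2.1, hut.2.1]
  · linarith [h0.1, hvt.1, h0.2.1, hut.2.1]
  · rcases hε₁ with rfl | rfl <;> linarith [h0.1, huyy.1, hvt.1, h0.2.1, hut.2.1]

end SymmetryCondition

/-- The angle function of a vector field that acts on the `(u, v)`-plane by dilations and
rotations `v ∂_u - u ∂_v`. -/
abbrev angle (V : VF) : J0 → ℝ := ∂v (eta V 0)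

section Splitting

variable {ε₁ ε₂ δ₁ δ₂ : ℝ} {V : VF}

theorem IsSymmetry.schrodinger_re (hε₁ : ε₁ = 1 ∨ ε₁ = -1) (hV : IsSymmetry ε₁ ε₂ δ₁ δ₂ V)
    (z : J0) (p : Fin 3 → Fin 3 → ℝ) (hp : p 0 0 = 0 ∧ p 1 0 = 0) :
    -∂t (eta V 1) z + ∂t (xi V 1) z * p 1 1 + ∂t (xi V 2) z * p 1 2
      + (∂x (∂x (eta V 0)) z + 2 * (p 0 1 * ∂x (∂u (eta V 0)) z + p 1 1 * ∂x (angle V) z)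
        + p 0 1 ^ 2 * ∂u (∂u (eta V 0)) z + 2 * p 0 1 * p 1 1 * ∂u (angle V) z
        + p 1 1 ^ 2 * ∂v (angle V) z
        - ∂x (∂x (xi V 1)) z * p 0 1 - ∂x (∂x (xi V 2)) z * p 0 2)
      + ε₁ * (∂y (∂y (eta V 0)) z + 2 * (p 0 2 * ∂y (∂u (eta V 0)) z + p 1 2 * ∂y (angle V) z)
        + p 0 2 ^ 2 * ∂u (∂u (eta V 0)) z + 2 * p 0 2 * p 1 2 * ∂u (angle V) z
        + p 1 2 ^ 2 * ∂v (angle V) z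
        - ∂y (∂y (xi V 1)) z * p 0 1 - ∂y (∂y (xi V 2)) z * p 0 2)
      + (ε₂ * (z.2 0 ^ 2 + z.2 1 ^ 2) + p 2 2)
        * (z.2 0 * (∂u (eta V 0) z - ∂t (xi V 0) z) + z.2 1 * angle V z)
      - ε₂ * ((3 * z.2 0 ^ 2 + z.2 1 ^ 2) * eta V 0 z + 2 * z.2 0 * z.2 1 * eta V 1 z)
      - eta V 0 z * p 2 2 - z.2 0 * (∂y (eta V 2) z + p 2 2 * ∂φ (eta V 2) z
        - ∂y (xi V 1) z * p 2 1 - ∂t (xi V 0) z / 2 * p 2 2) = 0 := by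
  have hproj := hV.isProjectable (by rcases hε₁ with rfl | rfl <;> norm_num)
  have h := (isSymmetry_iff.1 hV _ (solvedJet_symm ε₁ ε₂ δ₁ δ₂ z p 0 0 0 0)
    (system_solvedJet ..)).1
  obtain ⟨hu1, hφ0, hφ1, hu2, hv2, hv1, hx, hy⟩ := hV.pd_eta_first hε₁
  simp only [hproj.prol1_eq, hproj.prol2_diag _ _ (solvedJet_symm ε₁ ε₂ δ₁ δ₂ z _ _ _ _ _),
    Fin.sum_univ_three, pd_lift, pd_lift_pd_lift (contDiff_eta V _),
    pd_comm (contDiff_eta V 0) (fibreDir 2) (fibreDir _),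
    pd_comm (contDiff_eta V 0) (fibreDir 1) (fibreDir 0), hproj.pd_x, hproj.pd_y] at h
  simp [solvedJet, pd_zero, hp, hφ0, hφ1, hu2, hv2, hu1, hv1, congrFun hx z, congrFun hy z] at h
  linear_combination h

theorem IsSymmetry.schrodinger_im (hε₁ : ε₁ = 1 ∨ ε₁ = -1) (hV : IsSymmetry ε₁ ε₂ δ₁ δ₂ V)
    (z : J0) (s : ℝ) :
    ∂t (eta V 0) z + ∂x (∂x (eta V 1)) z + ε₁ * ∂y (∂y (eta V 1)) z
      + (ε₂ * (z.2 0 ^ 2 + z.2 1 ^ 2) + s)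
        * (z.2 1 * (∂u (eta V 0) z - ∂t (xi V 0) z) - z.2 0 * angle V z)
      - ε₂ * ((z.2 0 ^ 2 + 3 * z.2 1 ^ 2) * eta V 1 z + 2 * z.2 0 * z.2 1 * eta V 0 z)
      - eta V 1 z * s - z.2 1 * (∂y (eta V 2) z + s * ∂φ (eta V 2) z
        - ∂t (xi V 0) z / 2 * s) = 0 := by
  have hproj := hV.isProjectable (by rcases hε₁ with rfl | rfl <;> norm_num)
  have h := (isSymmetry_iff.1 hV _ (solvedJet_symm ε₁ ε₂ δ₁ δ₂ z ![0, 0, ![0, 0, s]] 0 0 0 0)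
    (system_solvedJet ..)).2.1
  obtain ⟨hu1, hφ0, hφ1, hu2, hv2, hv1, hx, hy⟩ := hV.pd_eta_first hε₁
  simp only [hproj.prol1_eq, hproj.prol2_diag _ _ (solvedJet_symm ε₁ ε₂ δ₁ δ₂ z _ _ _ _ _),
    Fin.sum_univ_three, pd_lift, pd_lift_pd_lift (contDiff_eta V _),
    pd_comm (contDiff_eta V 1) (fibreDir 2) (fibreDir _), hproj.pd_x, hproj.pd_y] at h
  simp [solvedJet, pd_zero, hφ0, hφ1, hu2, hv2, hu1, hv1, congrFun hx z, congrFun hy z] at h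
  linear_combination h

theorem IsSymmetry.poisson (hε₁ : ε₁ = 1 ∨ ε₁ = -1) (hV : IsSymmetry ε₁ ε₂ δ₁ δ₂ V) (z : J0) :
    ∂x (∂x (eta V 2)) z + δ₁ * ∂y (∂y (eta V 2)) z
      - 2 * δ₂ * (z.2 0 * ∂y (eta V 0) z + z.2 1 * ∂y (eta V 1) z) = 0 := by
  have hproj := hV.isProjectable (by rcases hε₁ with rfl | rfl <;> norm_num)
  have h := (isSymmetry_iff.1 hV _ (solvedJet_symm ε₁ ε₂ δ₁ δ₂ z 0 0 0 0 0)
    (system_solvedJet ..)).2.2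
  obtain ⟨-, -, -, hu2, hv2, -, -, -⟩ := hV.pd_eta_first hε₁
  simp only [hproj.prol1_eq, hproj.prol2_diag _ _ (solvedJet_symm ε₁ ε₂ δ₁ δ₂ z _ _ _ _ _),
    Fin.sum_univ_three, pd_lift, pd_lift_pd_lift (contDiff_eta V _)] at h
  simp [solvedJet, hu2, hv2] at h
  linear_combination h

theorem IsSymmetry.pd_pd_eta (hε₁ : ε₁ = 1 ∨ ε₁ = -1) (hV : IsSymmetry ε₁ ε₂ δ₁ δ₂ V) :
    ∂u (∂u (eta V 0)) = 0 ∧ ∂u (angle V) = 0 ∧ ∂v (angle V) = 0 ∧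
      ∂x (angle V) = (fun z => -∂t (xi V 1) z / 2) ∧
      ∂y (angle V) = (fun z => -ε₁ * ∂t (xi V 2) z / 2) := by
  simp only [funext_iff, ← forall_and, Pi.zero_apply]
  intro z
  have htest := hV.schrodinger_re hε₁ z
  have h0 := htest 0
  have hux := htest ![![0, 1, 0], 0, 0]
  have hux' := htest ![![0, -1, 0], 0, 0]
  have hvx := htest ![0, ![0, 1, 0], 0]
  have hvx' := htest ![0, ![0, -1, 0], 0]
  have huvx := htest ![![0, 1, 0], ![0, 1, 0], 0]
  have hvy := htest ![0, ![0, 0, 1], 0]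
  have hvy' := htest ![0, ![0, 0, -1], 0]
  simp only [Pi.zero_apply, and_self, mul_zero, add_zero, zero_mul, ne_eq, OfNat.ofNat_ne_zero,
    not_false_eq_true, zero_pow, sub_zero, forall_const, Matrix.cons_val, one_mul, one_pow, mul_one,
    neg_mul, mul_neg, even_two, Even.neg_pow, sub_neg_eq_add, zero_add, neg_zero]
    at h0 hux hux' hvx hvx' huvx hvy hvy'
  have huu : ∂u (∂u (eta V 0)) z = 0 := by linear_combination (hux + hux') / 2 - h0
  have hvv : ∂v (angle V) z = 0 := by linear_combination (hvx + hvx') / 2 - h0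
  refine ⟨huu, ?_, hvv, ?_, ?_⟩
  · linear_combination (huvx - hux - hvx + h0) / 2
  · linear_combination (hvx - hvx') / 4
  · rcases hε₁ with rfl | rfl
    · linear_combination (hvy - hvy') / 4
    · linear_combination (hvy' - hvy) / 4

theorem IsSymmetry.eta_eq (hε₁ : ε₁ = 1 ∨ ε₁ = -1) (hV : IsSymmetry ε₁ ε₂ δ₁ δ₂ V) (z : J0) :
    z.2 0 * ∂y (xi V 1) z = 0 ∧
      eta V 0 z = z.2 0 * (∂u (eta V 0) z - ∂t (xi V 0) z / 2 - ∂φ (eta V 2) z)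
        + z.2 1 * angle V z ∧
      eta V 1 z = z.2 1 * (∂u (eta V 0) z - ∂t (xi V 0) z / 2 - ∂φ (eta V 2) z)
        - z.2 0 * angle V z := by
  have htest := hV.schrodinger_re hε₁ z
  have h0 := htest 0
  have hφx := htest ![0, 0, ![0, 1, 0]]
  have hφy := htest ![0, 0, ![0, 0, 1]]
  simp at h0 hφx hφy
  refine ⟨?_, ?_, ?_⟩
  · linear_combination hφx - h0
  · linear_combination h0 - hφy
  · linear_combination hV.schrodinger_im hε₁ z 0 - hV.schrodinger_im hε₁ z 1

end Splitting

theorem eq_zero_of_cubic {G A B : J0 → ℝ} {c : ℝ} (hc : c ≠ 0)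
    (hG : ContDiff ℝ ∞ G) (hA : ContDiff ℝ ∞ A) (hB : ContDiff ℝ ∞ B)
    (hGu : ∂u G = 0) (hGv : ∂v G = 0) (hAu : ∂u A = 0) (hAv : ∂v A = 0) (hBu : ∂u B = 0)
    (h : ∀ z, c * (z.2 0 * (z.2 0 ^ 2 + z.2 1 ^ 2) * G z) + z.2 0 * A z + z.2 1 * B z = 0) :
    G = 0 ∧ A = 0 := by
  have hG' := hG.differentiable (by simp)
  have hA' := hA.differentiable (by simp)
  have hB' := hB.differentiable (by simp)
  have hu : ∀ z, c * ((3 * z.2 0 ^ 2 + z.2 1 ^ 2) * G z) + A z = 0 := by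
    intro z
    have := congrFun (congrArg ∂u (funext h)) z
    simp (disch := fun_prop) only [pd_add, pd_mul, pd_pow, pd_const, pd_snd, hGu, hAu, hBu] at this
    simp at this
    linear_combination this
  have huv : ∀ z, z.2 1 * G z = 0 := by
    intro z
    have := congrFun (congrArg ∂v (funext hu)) z
    simp (disch := fun_prop) only [pd_add, pd_mul, pd_pow, pd_const, pd_snd, hGv, hAv] at this
    simpa [hc] using this
  have hzero : G = 0 := by
    funext z
    have := congrFun (congrArg ∂v (funext huv)) z
    simp (disch := fun_prop) only [pd_mul, pd_const, pd_snd, hGv] at this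
    simpa using this
  refine ⟨hzero, funext fun z => ?_⟩
  simpa [hzero] using hu z

@[fun_prop]
theorem differentiable_pd {E : Type*} [NormedAddCommGroup E] [NormedSpace ℝ E] {F : E → ℝ}
    (hF : ContDiff ℝ ∞ F) (v : E) : Differentiable ℝ (pd v F) :=
  (contDiff_pd v hF).differentiable (by simp)

theorem pd_pd_eq_zero {E : Type*} [NormedAddCommGroup E] [NormedSpace ℝ E] {F : E → ℝ} {v : E}
    (hF : ContDiff ℝ ∞ F) (h : pd v F = 0) (w : E) : pd v (pd w F) = 0 := by
  rw [pd_comm hF, h, pd_zero]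

/-- The determining equations of the symmetries of the system, in integrated form as far as the
dependence on `u` and `v` is concerned. -/
structure DeterminingEquations (ε₁ δ₁ : ℝ) (V : VF) : Prop extends IsProjectable V where
  pd_x_xi_one : ∂x (xi V 1) = fun z => ∂t (xi V 0) z / 2
  pd_y_xi_one : ∂y (xi V 1) = 0
  pd_x_xi_two : ∂x (xi V 2) = 0
  pd_y_xi_two : ∂y (xi V 2) = fun z => ∂t (xi V 0) z / 2
  eta_zero : eta V 0 = fun z => -(∂t (xi V 0) z / 2 * z.2 0) + angle V z * z.2 1
  eta_one : eta V 1 = fun z => -(∂t (xi V 0) z / 2 * z.2 1) - angle V z * z.2 0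
  pd_fibre_angle : ∀ a, pd (fibreDir a) (angle V) = 0
  pd_x_angle : ∂x (angle V) = fun z => -∂t (xi V 1) z / 2
  pd_y_angle : ∂y (angle V) = fun z => -ε₁ * ∂t (xi V 2) z / 2
  pd_u_eta_two : ∂u (eta V 2) = 0
  pd_v_eta_two : ∂v (eta V 2) = 0
  pd_φ_eta_two : ∂φ (eta V 2) = fun z => -∂t (xi V 0) z / 2
  pd_y_eta_two : ∂y (eta V 2) = ∂t (angle V)
  laplace : (fun z => ∂x (∂x (eta V 2)) z + δ₁ * ∂y (∂y (eta V 2)) z) = 0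

section Splitting

variable {ε₁ ε₂ δ₁ δ₂ : ℝ} {V : VF}

theorem IsSymmetry.pd_y_xi_one (hε₁ : ε₁ = 1 ∨ ε₁ = -1) (hV : IsSymmetry ε₁ ε₂ δ₁ δ₂ V) :
    ∂y (xi V 1) = 0 := by
  have hproj := hV.isProjectable (by rcases hε₁ with rfl | rfl <;> norm_num)
  refine (eq_zero_of_cubic one_ne_zero (contDiff_const (c := 0)) (by fun_prop)
    (contDiff_const (c := 0)) (pd_const _ 0) (pd_const _ 0)
    (pd_pd_eq_zero (contDiff_xi V 1) (hproj.pd_fibre 1 0) _)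
    (pd_pd_eq_zero (contDiff_xi V 1) (hproj.pd_fibre 1 1) _) (pd_const _ 0) fun z => ?_).2
  linear_combination (hV.eta_eq hε₁ z).1

theorem IsSymmetry.pd_φ_eta_two (hε₁ : ε₁ = 1 ∨ ε₁ = -1) (hV : IsSymmetry ε₁ ε₂ δ₁ δ₂ V) :
    ∂φ (eta V 2) = fun z => -∂t (xi V 0) z / 2 := by
  have hproj := hV.isProjectable (by rcases hε₁ with rfl | rfl <;> norm_num)
  obtain ⟨-, -, -, hu2, -⟩ := hV.pd_eta_first hε₁
  obtain ⟨huu, huv, -⟩ := hV.pd_pd_eta hε₁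
  have hξu := pd_pd_eq_zero (contDiff_xi V 0) (hproj.pd_fibre 0 0) (baseDir 0)
  have hηu := pd_pd_eq_zero (contDiff_eta V 2) hu2 (fibreDir 2)
  have hη0 := funext fun z => (hV.eta_eq hε₁ z).2.1
  funext z
  have h := congrFun (congrArg ∂u hη0) z
  simp (disch := fun_prop) only [pd_add, pd_sub, pd_mul, pd_div_const, pd_snd, huu, huv, hξu,
    hηu] at h
  simp at h
  linear_combination h

theorem IsSymmetry.eta_eq_of_angle (hε₁ : ε₁ = 1 ∨ ε₁ = -1) (hV : IsSymmetry ε₁ ε₂ δ₁ δ₂ V) :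
    eta V 0 = (fun z => z.2 0 * ∂u (eta V 0) z + z.2 1 * angle V z) ∧
      eta V 1 = fun z => z.2 1 * ∂u (eta V 0) z - z.2 0 * angle V z := by
  have hφ := congrFun (hV.pd_φ_eta_two hε₁)
  constructor <;> funext z
  · linear_combination (hV.eta_eq hε₁ z).2.1 - z.2 0 * hφ z
  · linear_combination (hV.eta_eq hε₁ z).2.2 - z.2 1 * hφ z

theorem IsSymmetry.schrodinger_re_of_angle (hε₁ : ε₁ = 1 ∨ ε₁ = -1)
    (hV : IsSymmetry ε₁ ε₂ δ₁ δ₂ V) (z : J0) :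
    ε₂ * (z.2 0 * (z.2 0 ^ 2 + z.2 1 ^ 2) * (-∂t (xi V 0) z - 2 * ∂u (eta V 0) z))
      + z.2 0 * (∂t (angle V) z + ∂x (∂x (∂u (eta V 0))) z + ε₁ * ∂y (∂y (∂u (eta V 0))) z
        - ∂y (eta V 2) z)
      + z.2 1 * (-∂t (∂u (eta V 0)) z + ∂x (∂x (angle V)) z + ε₁ * ∂y (∂y (angle V)) z) = 0 := by
  obtain ⟨hη0, hη1⟩ := hV.eta_eq_of_angle hε₁
  have hre := hV.schrodinger_re hε₁ z 0 ⟨rfl, rfl⟩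
  have hα : ContDiff ℝ ∞ (∂u (eta V 0)) := by fun_prop
  have hθ : ContDiff ℝ ∞ (angle V) := by fun_prop
  generalize angle V = θ at *
  generalize ∂u (eta V 0) = α at *
  have hα' := hα.differentiable (by simp)
  have hθ' := hθ.differentiable (by simp)
  rw [hη0, hη1] at hre
  simp (disch := fun_prop) [pd_add, pd_sub, pd_mul, pd_snd] at hre
  linear_combination hre

theorem IsSymmetry.pd_u_eta_zero (hε₁ : ε₁ = 1 ∨ ε₁ = -1) (hε₂ : ε₂ ≠ 0)
    (hV : IsSymmetry ε₁ ε₂ δ₁ δ₂ V) :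
    ∂u (eta V 0) = (fun z => -∂t (xi V 0) z / 2) ∧ ∂y (eta V 2) = ∂t (angle V) := by
  have hproj := hV.isProjectable (by rcases hε₁ with rfl | rfl <;> norm_num)
  obtain ⟨-, -, -, hu2, hv2, -⟩ := hV.pd_eta_first hε₁
  obtain ⟨huu, huv, hvv, -⟩ := hV.pd_pd_eta hε₁
  have hvu : ∂v (∂u (eta V 0)) = 0 := by rw [pd_comm (contDiff_eta V 0), huv]
  have hre := hV.schrodinger_re_of_angle hε₁
  have hα : ContDiff ℝ ∞ (∂u (eta V 0)) := by fun_prop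
  have hθ : ContDiff ℝ ∞ (angle V) := by fun_prop
  have hη2 := contDiff_eta V 2
  have hξ := contDiff_xi V 0
  generalize angle V = θ at *
  generalize ∂u (eta V 0) = α at *
  have hα' := hα.differentiable (by simp)
  have hvert (w : J0) (hαw : pd w α = 0) (hθw : pd w θ = 0) (hηw : pd w (eta V 2) = 0)
      (hξw : pd w (xi V 0) = 0) : pd w (fun z => -∂t (xi V 0) z - 2 * α z) = 0 ∧
      pd w (fun z => ∂t θ z + ∂x (∂x α) z + ε₁ * ∂y (∂y α) z - ∂y (eta V 2) z) = 0 ∧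
      pd w (fun z => -∂t α z + ∂x (∂x θ) z + ε₁ * ∂y (∂y θ) z) = 0 := by
    have hpd := @pd_pd_eq_zero J0 _ _
    simp (disch := fun_prop) only [pd_add, pd_sub, pd_mul, pd_neg, pd_const, hαw,
      hpd hξ hξw, hpd hα hαw, hpd hθ hθw, hpd hη2 hηw, hpd (contDiff_pd _ hα) (hpd hα hαw _),
      hpd (contDiff_pd _ hθ) (hpd hθ hθw _), Pi.zero_apply, mul_zero, zero_mul, add_zero, sub_zero,
      neg_zero]
    exact ⟨rfl, rfl, rfl⟩
  obtain ⟨hGu, hAu, hBu⟩ := hvert _ huu huv hu2 (hproj.pd_fibre 0 0)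
  obtain ⟨hGv, hAv, -⟩ := hvert _ hvu hvv hv2 (hproj.pd_fibre 0 1)
  obtain ⟨hG, hA⟩ := eq_zero_of_cubic hε₂ (by fun_prop) (by fun_prop) (by fun_prop)
    hGu hGv hAu hAv hBu hre
  obtain rfl : α = fun z => -∂t (xi V 0) z / 2 := by
    funext z
    have hGz := congrFun hG z
    dsimp only [Pi.zero_apply] at hGz
    linear_combination -hGz / 2
  refine ⟨rfl, funext fun z => ?_⟩
  have hAz := congrFun hA z
  simp (disch := fun_prop) only [pd_neg, pd_div_const, pd_pd_eq_zero hξ hproj.pd_x,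
    pd_pd_eq_zero hξ hproj.pd_y, pd_const, Pi.zero_apply, neg_zero, zero_div] at hAz
  linear_combination -hAz

theorem IsSymmetry.determiningEquations (hε₁ : ε₁ = 1 ∨ ε₁ = -1) (hε₂ : ε₂ ≠ 0)
    (hV : IsSymmetry ε₁ ε₂ δ₁ δ₂ V) : DeterminingEquations ε₁ δ₁ V := by
  have hproj := hV.isProjectable (by rcases hε₁ with rfl | rfl <;> norm_num)
  obtain ⟨-, hφ0, -, hu2, hv2, -, hx1, hy2⟩ := hV.pd_eta_first hε₁
  obtain ⟨-, huv, hvv, hxv, hyv⟩ := hV.pd_pd_eta hε₁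
  obtain ⟨hη0, hη1⟩ := hV.eta_eq_of_angle hε₁
  obtain ⟨hα, hy⟩ := hV.pd_u_eta_zero hε₁ hε₂
  have hy1 := hV.pd_y_xi_one hε₁
  refine ⟨hproj, hx1, hy1, funext fun z => ?_, hy2, funext fun z => ?_, funext fun z => ?_, ?_,
    hxv, hyv, hu2, hv2, hV.pd_φ_eta_two hε₁, hy, funext fun z => ?_⟩
  · simpa [pd_lift, hy1] using (hV.pd_lift_xi z 0).2.2
  · linear_combination congrFun hη0 z + z.2 0 * congrFun hα z
  · linear_combination congrFun hη1 z + z.2 1 * congrFun hα z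
  · intro a
    fin_cases a
    exacts [huv, hvv, pd_pd_eq_zero (contDiff_eta V 0) hφ0 _]
  · have hα' : ∂y (∂u (eta V 0)) z = 0 := by
      rw [hα]
      simp (disch := fun_prop) [pd_neg, pd_div_const, pd_pd_eq_zero (contDiff_xi V 0) hproj.pd_y]
    have hη0y := congrFun (congrArg ∂y hη0) z
    have hη1y := congrFun (congrArg ∂y hη1) z
    simp (disch := fun_prop) [pd_add, pd_sub, pd_mul, pd_snd, hα'] at hη0y hη1y
    dsimp only [Pi.zero_apply]
    linear_combination hV.poisson hε₁ z + 2 * δ₂ * (z.2 0 * hη0y + z.2 1 * hη1y)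

end Splitting

namespace DeterminingEquations

variable {ε₁ ε₂ δ₁ δ₂ : ℝ} {V : VF}

theorem pd_time_xi_zero (hV : DeterminingEquations ε₁ δ₁ V) :
    ∂x (∂t (xi V 0)) = 0 ∧ ∂y (∂t (xi V 0)) = 0 ∧ ∀ a, pd (fibreDir a) (∂t (xi V 0)) = 0 :=
  ⟨pd_pd_eq_zero (contDiff_xi V 0) hV.pd_x _, pd_pd_eq_zero (contDiff_xi V 0) hV.pd_y _,
    fun a => pd_pd_eq_zero (contDiff_xi V 0) (hV.pd_fibre 0 a) _⟩

theorem pd_eta (hV : DeterminingEquations ε₁ δ₁ V) (v : J0) :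
    pd v (eta V 0) = (fun z => -(pd v (∂t (xi V 0)) z / 2 * z.2 0 + ∂t (xi V 0) z / 2 * v.2 0)
        + pd v (angle V) z * z.2 1 + angle V z * v.2 1) ∧
      pd v (eta V 1) = fun z => -(pd v (∂t (xi V 0)) z / 2 * z.2 1 + ∂t (xi V 0) z / 2 * v.2 1)
        - pd v (angle V) z * z.2 0 - angle V z * v.2 0 := by
  have hθ : ContDiff ℝ ∞ (angle V) := by fun_prop
  have h0 := hV.eta_zero
  have h1 := hV.eta_one
  generalize angle V = θ at *
  have hθ' := hθ.differentiable (by simp)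
  rw [h0, h1]
  simp (disch := fun_prop) only [pd_add, pd_sub, pd_neg, pd_mul, pd_div_const, pd_snd]
  constructor <;> funext z <;> ring

theorem pd_fibre_eta (hV : DeterminingEquations ε₁ δ₁ V) :
    ∂u (eta V 0) = (fun z => -(∂t (xi V 0) z / 2)) ∧ ∂φ (eta V 0) = 0 ∧
      ∂u (eta V 1) = -angle V ∧ ∂v (eta V 1) = (fun z => -(∂t (xi V 0) z / 2)) ∧
      ∂φ (eta V 1) = 0 := by
  simp only [(hV.pd_eta (fibreDir _)).2, (hV.pd_eta (fibreDir 0)).1, (hV.pd_eta (fibreDir 2)).1,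
    hV.pd_fibre_angle, hV.pd_time_xi_zero.2.2]
  refine ⟨?_, ?_, ?_, ?_, ?_⟩ <;> funext z <;> simp

theorem pd_pd_angle (hV : DeterminingEquations ε₁ δ₁ V) :
    ∂x (∂x (angle V)) = (fun z => -∂t (∂t (xi V 0)) z / 4) ∧
      ∂y (∂y (angle V)) = fun z => -ε₁ * ∂t (∂t (xi V 0)) z / 4 := by
  rw [hV.pd_x_angle, hV.pd_y_angle]
  simp (disch := fun_prop) only [pd_neg, pd_mul, pd_const, pd_div_const,
    pd_comm (contDiff_xi V _) _ (baseDir 0), hV.pd_x_xi_one, hV.pd_y_xi_two, Pi.zero_apply]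
  constructor <;> funext z <;> ring

theorem pd_lift_time_xi_zero (hV : DeterminingEquations ε₁ δ₁ V) (p : Fin 3 → Fin 3 → ℝ)
    {i : Fin 3} (hi : pd (baseDir i) (∂t (xi V 0)) = 0) :
    pd (lift p i) (∂t (xi V 0)) = 0 := by
  funext z
  simp [pd_lift, hi, hV.pd_time_xi_zero.2.2]

theorem pd_lift_angle (hV : DeterminingEquations ε₁ δ₁ V) (p : Fin 3 → Fin 3 → ℝ) (i : Fin 3) :
    pd (lift p i) (angle V) = pd (baseDir i) (angle V) := by
  funext z
  simp [pd_lift, hV.pd_fibre_angle]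

theorem pd_lift_eta_two (hV : DeterminingEquations ε₁ δ₁ V) (p : Fin 3 → Fin 3 → ℝ) (i : Fin 3) :
    pd (lift p i) (eta V 2) =
      fun z => pd (baseDir i) (eta V 2) z - p 2 i * (∂t (xi V 0) z / 2) := by
  funext z
  simp [pd_lift, Fin.sum_univ_three, hV.pd_u_eta_two, hV.pd_v_eta_two, hV.pd_φ_eta_two]
  ring

theorem pd_lift_pd_lift_eta (hV : DeterminingEquations ε₁ δ₁ V) (p : Fin 3 → Fin 3 → ℝ)
    {i : Fin 3} (hi : pd (baseDir i) (∂t (xi V 0)) = 0) :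
    pd (lift p i) (pd (lift p i) (eta V 0)) = (fun z =>
        pd (baseDir i) (pd (baseDir i) (angle V)) z * z.2 1
          + 2 * pd (baseDir i) (angle V) z * p 1 i) ∧
      pd (lift p i) (pd (lift p i) (eta V 1)) = (fun z =>
        -(pd (baseDir i) (pd (baseDir i) (angle V)) z * z.2 0)
          - 2 * pd (baseDir i) (angle V) z * p 0 i) ∧
      pd (lift p i) (pd (lift p i) (eta V 2)) = pd (baseDir i) (pd (baseDir i) (eta V 2)) := by
  have hθ : ContDiff ℝ ∞ (angle V) := by fun_prop
  have hσ := hV.pd_lift_time_xi_zero p hi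
  have hlift := hV.pd_lift_angle p i
  have hlift' : pd (lift p i) (pd (baseDir i) (angle V)) =
      pd (baseDir i) (pd (baseDir i) (angle V)) := by rw [pd_comm hθ, hlift]
  rw [(hV.pd_eta _).1, (hV.pd_eta _).2, hlift, hσ]
  generalize angle V = θ at *
  have hθ' := hθ.differentiable (by simp)
  refine ⟨?_, ?_, ?_⟩
  · simp (disch := fun_prop) only [pd_add, pd_neg, pd_mul, pd_div_const, pd_const, pd_snd,
      hσ, hlift, hlift', Pi.zero_apply, zero_div, zero_mul, zero_add]
    funext z
    simp [lift]
    ring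
  · simp (disch := fun_prop) only [pd_sub, pd_neg, pd_mul, pd_div_const, pd_const, pd_snd,
      hσ, hlift, hlift', Pi.zero_apply, zero_div, zero_mul, zero_add]
    funext z
    simp [lift]
    ring
  · rw [hV.pd_lift_eta_two]
    simp (disch := fun_prop) only [pd_sub, pd_mul, pd_div_const, pd_const, hσ,
      pd_comm (contDiff_eta V 2) (lift p i), hV.pd_lift_eta_two, hi]
    simp

protected theorem isSymmetry (hε₁ : ε₁ = 1 ∨ ε₁ = -1) (hV : DeterminingEquations ε₁ δ₁ V) :
    IsSymmetry ε₁ ε₂ δ₁ δ₂ V := by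
  rw [isSymmetry_iff]
  intro j hj hsys
  obtain ⟨hσx, hσy, hσ⟩ := hV.pd_time_xi_zero
  obtain ⟨hxx0, hxx1, hxx2⟩ := hV.pd_lift_pd_lift_eta j.1.2 hσx
  obtain ⟨hyy0, hyy1, hyy2⟩ := hV.pd_lift_pd_lift_eta j.1.2 hσy
  obtain ⟨hθxx, hθyy⟩ := hV.pd_pd_angle
  have hlap := congrFun hV.laplace j.1.1
  rw [system_eq] at hsys
  have h0 := congrFun hsys 0
  have h1 := congrFun hsys 1
  have h2 := congrFun hsys 2
  obtain ⟨hu0, hφ0, hu1, hv1, hφ1⟩ := hV.pd_fibre_eta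
  have hσt (p) : pd (lift p 0) (∂t (xi V 0)) = ∂t (∂t (xi V 0)) := by
    funext z
    simp [pd_lift, hσ]
  simp at h0 h1 h2 hlap
  simp only [hV.prol1_eq, hV.prol2_diag _ _ hj, hxx0, hxx1, hxx2, hyy0, hyy1, hyy2,
    Fin.sum_univ_three]
  simp only [hV.pd_lift_eta_two, (hV.pd_eta (lift _ _)).1, (hV.pd_eta (lift _ _)).2, hV.pd_x,
    hV.pd_y, hV.pd_x_xi_one, hV.pd_y_xi_one, hV.pd_x_xi_two, hV.pd_y_xi_two, hθxx, hθyy, hσt,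
    hV.pd_lift_time_xi_zero _ hσy, hV.pd_lift_angle,
    congrFun hV.eta_zero j.1.1, congrFun hV.eta_one j.1.1]
  simp (disch := fun_prop) only [lift, pd_div_const, hσx, hσy, hV.pd_x_angle, hV.pd_y_angle,
    hV.pd_u_eta_two, hV.pd_v_eta_two, hV.pd_φ_eta_two, pd_zero, hu0, hφ0, hu1, hv1, hφ1,
    Pi.zero_apply, Pi.neg_apply, mul_zero, zero_mul, zero_div, add_zero, zero_add, mul_neg, neg_mul,
    neg_add_rev, neg_sub]
  have hyt := congrFun hV.pd_y_eta_two j.1.1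
  refine ⟨?_, ?_, ?_⟩
  · rcases hε₁ with rfl | rfl <;>
      linear_combination -3 / 2 * ∂t (xi V 0) j.1.1 * h0 + angle V j.1.1 * h1 - j.1.1.2 0 * hyt
  · rcases hε₁ with rfl | rfl <;>
      linear_combination -3 / 2 * ∂t (xi V 0) j.1.1 * h1 - angle V j.1.1 * h0 - j.1.1.2 1 * hyt
  · linear_combination -3 / 2 * ∂t (xi V 0) j.1.1 * h2 + hlap

end DeterminingEquations

/-! ### Integration of the determining equations -/

theorem pd_fibre_phase (ε₁ : ℝ) (c : Coeffs) (a : Fin 3) :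
    pd (fibreDir a) (phase ε₁ c) = 0 := by
  obtain ⟨τ, α, β, μ, γ, δ⟩ := c
  funext z
  simp [pd_phase]

theorem angle_generalField (ε₁ δ₁ : ℝ) (c : Coeffs) :
    angle (generalField ε₁ δ₁ c) = phase ε₁ c := by
  obtain ⟨τ, α, β, μ, γ, δ⟩ := c
  funext z
  refine (congrFun (pd_eta_generalField ..) 0).trans ?_
  simp [pd_fibre_phase]

theorem laplace_generalField {ε₁ : ℝ} (hε₁ : ε₁ = 1 ∨ ε₁ = -1) (δ₁ : ℝ) (τ α β μ γ δ : C)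
    (z : J0) :
    ∂x (∂x (eta (generalField ε₁ δ₁ (τ, α, β, μ, γ, δ)) 2)) z
        + δ₁ * ∂y (∂y (eta (generalField ε₁ δ₁ (τ, α, β, μ, γ, δ)) 2)) z =
      -(ε₁ * z.1 2 / 4 * ((ε₁ + δ₁) * (D (D (D τ))).1 (z.1 0))) := by
  have hpd (v : J0) : pd v (eta (generalField ε₁ δ₁ (τ, α, β, μ, γ, δ)) 2) = _ :=
    funext fun z => congrFun (pd_eta_generalField ε₁ δ₁ τ α β μ γ δ v z) 2
  rw [hpd, hpd]
  simp (disch := fun_prop) only [pd_shift, pd_phase, pd_add, pd_sub, pd_neg, pd_mul, pd_div_const,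
    pd_const, pd_fst, pd_time, baseDir_fst, baseDir_snd, Matrix.cons_val, Fin.reduceEq, zero_ne_one,
    ↓reduceIte, Pi.zero_apply]
  rcases hε₁ with rfl | rfl <;> ring

theorem determiningEquations_generalField {ε₁ δ₁ : ℝ} (hε₁ : ε₁ = 1 ∨ ε₁ = -1)
    {τ α β μ γ δ : C} (h : (ε₁ + δ₁) • D (D (D τ)) = 0) :
    DeterminingEquations ε₁ δ₁ (generalField ε₁ δ₁ (τ, α, β, μ, γ, δ)) := by
  have hξ (v : J0) (k : Fin 3) := funext fun z =>
    congrFun (pd_xi_generalField ε₁ δ₁ τ α β μ γ δ v z) k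
  have hη (v : J0) (a : Fin 3) := funext fun z =>
    congrFun (pd_eta_generalField ε₁ δ₁ τ α β μ γ δ v z) a
  have hη' := eta_generalField ε₁ δ₁ τ α β μ γ δ
  have hτ (t : ℝ) : (ε₁ + δ₁) * (D (D (D τ))).1 t = 0 := congrArg (·.1 t) h
  exact
    { pd_fibre := fun k a => by funext z; fin_cases k <;> simp [hξ]
      pd_x := by funext z; simp [hξ]
      pd_y := by funext z; simp [hξ]
      pd_x_xi_one := by funext z; simp [hξ]
      pd_y_xi_one := by funext z; simp [hξ]
      pd_x_xi_two := by funext z; simp [hξ]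
      pd_y_xi_two := by funext z; simp [hξ]
      eta_zero := by funext z; simp [hξ, hη', angle_generalField]
      eta_one := by funext z; simp [hξ, hη', angle_generalField]
      pd_fibre_angle := fun a => by rw [angle_generalField, pd_fibre_phase]
      pd_x_angle := by
        funext z
        simp only [angle_generalField, pd_phase, hξ]
        simp
        ring
      pd_y_angle := by
        funext z
        simp only [angle_generalField, pd_phase, hξ]
        simp only [baseDir_fst, Fin.reduceEq, one_ne_zero, ↓reduceIte, Matrix.cons_val]
        rcases hε₁ with rfl | rfl <;> ring
      pd_u_eta_two := by funext z; simp [hη, pd_shift]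
      pd_v_eta_two := by funext z; simp [hη, pd_shift]
      pd_φ_eta_two := by
        funext z
        simp only [hη, hξ, pd_shift]
        simp
        ring
      pd_y_eta_two := by
        rw [angle_generalField]
        funext z
        simp [hη, pd_shift, pd_phase]
      laplace := by
        funext z
        simp only [laplace_generalField hε₁, hτ, mul_zero, neg_zero, Pi.zero_apply] }

/-- The point `(t, 0, 0, 0, 0, 0)`. -/
def axis (t : ℝ) : J0 := t • baseDir 0

theorem eq_of_pd_eq {F G : J0 → ℝ} (hF : Differentiable ℝ F) (hG : Differentiable ℝ G)
    (hx : ∂x F = ∂x G) (hy : ∂y F = ∂y G) (hfibre : ∀ a, pd (fibreDir a) F = pd (fibreDir a) G)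
    (haxis : ∀ t, F (axis t) = G (axis t)) : F = G := by
  funext z
  set w : J0 := z - axis (z.1 0) with hw
  have hw0 : w.1 0 = 0 := by simp [hw, axis]
  have hderiv (s : ℝ) :
      HasDerivAt (fun s => F (axis (z.1 0) + s • w) - G (axis (z.1 0) + s • w)) 0 s := by
    have hline : HasDerivAt (fun s : ℝ => axis (z.1 0) + s • w) w s := by
      simpa using ((hasDerivAt_id s).smul_const w).const_add (axis (z.1 0))
    have hsub := ((hF _).hasFDerivAt.comp_hasDerivAt s hline).sub
      ((hG _).hasFDerivAt.comp_hasDerivAt s hline)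
    have hpd : pd w F = pd w G := by
      funext z
      simp [pd_eq_sum w, Fin.sum_univ_three, hw0, hx, hy, hfibre]
    exact hsub.congr_deriv (sub_eq_zero.2 (congrFun hpd _))
  have h := is_const_of_deriv_eq_zero (fun s => (hderiv s).differentiableAt)
    (fun s => (hderiv s).deriv) 1 0
  simpa [haxis, sub_eq_zero, hw] using h

/-- The restriction of a smooth function to the line `x = y = u = v = φ = 0`. -/
def onAxis (F : J0 → ℝ) (hF : ContDiff ℝ ∞ F) : C :=
  ⟨fun t => F (axis t), hF.comp (contDiff_id.smul contDiff_const)⟩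

theorem D_onAxis {F : J0 → ℝ} (hF : ContDiff ℝ ∞ F) :
    D (onAxis F hF) = onAxis (∂t F) (contDiff_pd _ hF) := by
  ext t
  have haxis : HasDerivAt axis ((1 : ℝ) • baseDir 0) t :=
    (hasDerivAt_id t).smul_const (baseDir 0)
  rw [one_smul] at haxis
  exact ((hF.differentiable (by simp) _).hasFDerivAt.comp_hasDerivAt t haxis).deriv

/-- The functions of time which determine a solution of the determining equations. -/
def initialData (V : VF) : Coeffs :=
  (onAxis (xi V 0) (contDiff_xi V 0), onAxis (xi V 1) (contDiff_xi V 1),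
    onAxis (xi V 2) (contDiff_xi V 2), onAxis (angle V) (contDiff_pd _ (contDiff_eta V 0)),
    onAxis (∂x (eta V 2)) (contDiff_pd _ (contDiff_eta V 2)),
    onAxis (eta V 2) (contDiff_eta V 2))

theorem initialData_generalField (ε₁ δ₁ : ℝ) (c : Coeffs) :
    initialData (generalField ε₁ δ₁ c) = c := by
  obtain ⟨τ, α, β, μ, γ, δ⟩ := c
  simp only [initialData, Prod.mk.injEq]
  refine ⟨C.ext fun t => ?_, C.ext fun t => ?_, C.ext fun t => ?_, C.ext fun t => ?_,
    C.ext fun t => ?_, C.ext fun t => ?_⟩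
  · simp [onAxis, axis, xi_generalField]
  · simp [onAxis, axis, xi_generalField]
  · simp [onAxis, axis, xi_generalField]
  · simp [onAxis, axis, angle_generalField, phase]
  · refine (congrFun (pd_eta_generalField ..) 2).trans ?_
    simp [axis, pd_shift]
  · simp [onAxis, axis, eta_generalField, shift]

theorem generalField_injective (ε₁ δ₁ : ℝ) : Function.Injective (generalField ε₁ δ₁) :=
  Function.LeftInverse.injective (initialData_generalField ε₁ δ₁)

@[fun_prop]
theorem differentiable_xi (V : VF) (k : Fin 3) : Differentiable ℝ (xi V k) :=
  (contDiff_xi V k).differentiable (by simp)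

@[fun_prop]
theorem differentiable_eta (V : VF) (a : Fin 3) : Differentiable ℝ (eta V a) :=
  (contDiff_eta V a).differentiable (by simp)

theorem DeterminingEquations.eta_two_ext {ε₁ δ₁ : ℝ} {V V' : VF}
    (hV : DeterminingEquations ε₁ δ₁ V) (hV' : DeterminingEquations ε₁ δ₁ V')
    (hξ0 : xi V 0 = xi V' 0) (hangle : angle V = angle V')
    (hγ : ∀ t, ∂x (eta V 2) (axis t) = ∂x (eta V' 2) (axis t))
    (hδ : ∀ t, eta V 2 (axis t) = eta V' 2 (axis t)) : eta V 2 = eta V' 2 := by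
  have hy : ∂y (eta V 2) = ∂y (eta V' 2) := by rw [hV.pd_y_eta_two, hV'.pd_y_eta_two, hangle]
  have hfibre (a : Fin 3) : pd (fibreDir a) (eta V 2) = pd (fibreDir a) (eta V' 2) := by
    fin_cases a
    exacts [hV.pd_u_eta_two.trans hV'.pd_u_eta_two.symm,
      hV.pd_v_eta_two.trans hV'.pd_v_eta_two.symm,
      (hV.pd_φ_eta_two.trans (by rw [hξ0])).trans hV'.pd_φ_eta_two.symm]
  have hcomm (v : J0) (h : pd v (eta V 2) = pd v (eta V' 2)) :
      pd v (∂x (eta V 2)) = pd v (∂x (eta V' 2)) := by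
    rw [pd_comm (contDiff_eta V 2), pd_comm (contDiff_eta V' 2), h]
  have hxx : ∂x (∂x (eta V 2)) = ∂x (∂x (eta V' 2)) := by
    funext z
    have h := (congrFun hV.laplace z).trans (congrFun hV'.laplace z).symm
    simpa only [hy, add_left_inj] using h
  have hx : ∂x (eta V 2) = ∂x (eta V' 2) := eq_of_pd_eq (by fun_prop) (by fun_prop) hxx
    (hcomm _ hy) (fun a => hcomm _ (hfibre a)) hγ
  exact eq_of_pd_eq (by fun_prop) (by fun_prop) hx hy hfibre hδ

theorem DeterminingEquations.ext {ε₁ δ₁ : ℝ} {V V' : VF} (hV : DeterminingEquations ε₁ δ₁ V)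
    (hV' : DeterminingEquations ε₁ δ₁ V') (h : initialData V = initialData V') : V = V' := by
  simp only [initialData, Prod.mk.injEq, Subtype.ext_iff, onAxis, funext_iff] at h
  obtain ⟨h0, h1, h2, hθ, hγ, hδ⟩ := h
  have hξ0 : xi V 0 = xi V' 0 := eq_of_pd_eq (by fun_prop) (by fun_prop)
    (by rw [hV.pd_x, hV'.pd_x]) (by rw [hV.pd_y, hV'.pd_y])
    (fun a => by rw [hV.pd_fibre, hV'.pd_fibre]) h0
  have hξ1 : xi V 1 = xi V' 1 := eq_of_pd_eq (by fun_prop) (by fun_prop)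
    (by rw [hV.pd_x_xi_one, hV'.pd_x_xi_one, hξ0]) (by rw [hV.pd_y_xi_one, hV'.pd_y_xi_one])
    (fun a => by rw [hV.pd_fibre, hV'.pd_fibre]) h1
  have hξ2 : xi V 2 = xi V' 2 := eq_of_pd_eq (by fun_prop) (by fun_prop)
    (by rw [hV.pd_x_xi_two, hV'.pd_x_xi_two]) (by rw [hV.pd_y_xi_two, hV'.pd_y_xi_two, hξ0])
    (fun a => by rw [hV.pd_fibre, hV'.pd_fibre]) h2
  have hangle : angle V = angle V' := eq_of_pd_eq (by fun_prop) (by fun_prop)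
    (by rw [hV.pd_x_angle, hV'.pd_x_angle, hξ1]) (by rw [hV.pd_y_angle, hV'.pd_y_angle, hξ2])
    (fun a => by rw [hV.pd_fibre_angle, hV'.pd_fibre_angle]) hθ
  have hη2 : eta V 2 = eta V' 2 := hV.eta_two_ext hV' hξ0 hangle hγ hδ
  refine VF.ext_xi_eta ?_ ?_ <;> funext i <;> fin_cases i
  exacts [hξ0, hξ1, hξ2, by rw [Fin.zero_eta, hV.eta_zero, hV'.eta_zero, hξ0, hangle],
    by rw [Fin.mk_one, hV.eta_one, hV'.eta_one, hξ0, hangle], hη2]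

theorem DeterminingEquations.smul_D_D_D_eq_zero {ε₁ δ₁ : ℝ} {V : VF} (hε₁ : ε₁ = 1 ∨ ε₁ = -1)
    (hV : DeterminingEquations ε₁ δ₁ V) : (ε₁ + δ₁) • D (D (D (initialData V).1)) = 0 := by
  have hη : ContDiff ℝ ∞ (eta V 2) := by fun_prop
  have hθ : ContDiff ℝ ∞ (angle V) := by fun_prop
  have hpd (v : J0) : ∂y (pd v (pd v (eta V 2))) = ∂t (pd v (pd v (angle V))) := by
    rw [pd_comm (contDiff_pd v hη) _ v, pd_comm hη _ v, hV.pd_y_eta_two, pd_comm hθ v,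
      pd_comm (contDiff_pd v hθ) v]
  have hlaplace := congrArg ∂y hV.laplace
  simp (disch := fun_prop) only [pd_add, pd_mul, pd_const, pd_zero, hpd, hV.pd_pd_angle.1,
    hV.pd_pd_angle.2, pd_neg, pd_div_const] at hlaplace
  ext t
  have h := congrFun hlaplace (axis t)
  simp only [initialData, D_onAxis, C.smul_apply, C.zero_apply, Pi.zero_apply] at h ⊢
  change (ε₁ + δ₁) * ∂t (∂t (∂t (xi V 0))) (axis t) = 0
  rcases hε₁ with rfl | rfl
  · linear_combination -4 * h
  · linear_combination 4 * h

theorem isSymmetry_iff_exists_generalField {ε₁ ε₂ δ₁ δ₂ : ℝ} (hε₁ : ε₁ = 1 ∨ ε₁ = -1)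
    (hε₂ : ε₂ ≠ 0) {V : VF} :
    IsSymmetry ε₁ ε₂ δ₁ δ₂ V ↔
      ∃ c : Coeffs, (ε₁ + δ₁) • D (D (D c.1)) = 0 ∧ V = generalField ε₁ δ₁ c := by
  refine ⟨fun hV => ?_, ?_⟩
  · have hdet := hV.determiningEquations hε₁ hε₂
    have hτ := hdet.smul_D_D_D_eq_zero hε₁
    exact ⟨initialData V, hτ, hdet.ext (determiningEquations_generalField hε₁ hτ)
      (initialData_generalField ..).symm⟩
  · rintro ⟨c, hτ, rfl⟩
    exact (determiningEquations_generalField hε₁ hτ).isSymmetry hε₁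

/-! ### The symmetry algebra -/

theorem D_D_D_lie {c : ℝ} {τ τ' : C} (hτ : c • D (D (D τ)) = 0) (hτ' : c • D (D (D τ')) = 0) :
    c • D (D (D (τ * D τ' - D τ * τ'))) = 0 := by
  have h4 : c • D (D (D (D τ))) = 0 := by rw [← D.map_smul, hτ, map_zero]
  have h4' : c • D (D (D (D τ'))) = 0 := by rw [← D.map_smul, hτ', map_zero]
  simp only [C.ext_iff, C.smul_apply, C.zero_apply] at hτ hτ' h4 h4' ⊢
  intro t
  simp only [D_mul, map_add, map_sub, C.add_apply, C.sub_apply, C.mul_apply]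
  linear_combination τ.1 t * h4' t + 2 * (D τ).1 t * hτ' t - 2 * (D τ').1 t * hτ t
    - τ'.1 t * h4 t

/-- The Lie algebra of the general elements in which `τ` satisfies `(ε₁ + δ₁) τ''' = 0`. -/
def symmetryAlgebra {ε₁ : ℝ} (hε₁ : ε₁ = 1 ∨ ε₁ = -1) (δ₁ : ℝ) : LieSubalgebra ℝ VF where
  carrier := {V | ∃ c : Coeffs, (ε₁ + δ₁) • D (D (D c.1)) = 0 ∧ V = generalField ε₁ δ₁ c}
  add_mem' := by
    rintro _ _ ⟨c, h, rfl⟩ ⟨c', h', rfl⟩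
    exact ⟨c + c', by simp only [Prod.fst_add, map_add, smul_add, h, h', add_zero],
      (map_add _ c c').symm⟩
  zero_mem' := ⟨0, by simp, (map_zero _).symm⟩
  smul_mem' := by
    rintro r _ ⟨c, h, rfl⟩
    exact ⟨r • c, by simp only [Prod.smul_fst, D.map_smul, smul_comm _ r, h, smul_zero],
      (map_smul _ r c).symm⟩
  lie_mem' := by
    rintro _ _ ⟨c, h, rfl⟩ ⟨c', h', rfl⟩
    refine ⟨lieCoeffs ε₁ δ₁ c c', D_D_D_lie h h', lie_generalField hε₁ ?_⟩
    rw [smul_sub, ← smul_mul_assoc, ← smul_mul_assoc, h, h', zero_mul, zero_mul, sub_zero]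

theorem mem_symmetryAlgebra {ε₁ : ℝ} (hε₁ : ε₁ = 1 ∨ ε₁ = -1) (δ₁ : ℝ) {V : VF} :
    V ∈ symmetryAlgebra hε₁ δ₁ ↔ ∃ τ α β μ γ δ : C, (ε₁ + δ₁) • D (D (D τ)) = 0 ∧
      V = X ε₁ τ + Y α + Z ε₁ δ₁ β + W μ + R γ + S δ :=
  ⟨fun ⟨⟨τ, α, β, μ, γ, δ⟩, h⟩ => ⟨τ, α, β, μ, γ, δ, h⟩,
    fun ⟨τ, α, β, μ, γ, δ, h⟩ => ⟨(τ, α, β, μ, γ, δ), h⟩⟩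

/-- The function `t`. -/
def time : C := ⟨fun t => t, (contDiff_id : ContDiff ℝ ∞ fun t : ℝ => t)⟩

@[simp] theorem time_apply (t : ℝ) : time.1 t = t := rfl

theorem D_time : D time = 1 := by
  ext t
  exact (hasDerivAt_id t).deriv

theorem eq_smul_one_of_D_eq_zero {f : C} (h : D f = 0) : f = f.1 0 • (1 : C) := by
  ext t
  have hconst := is_const_of_deriv_eq_zero f.differentiable (congrFun (congrArg Subtype.val h)) t 0
  exact hconst.trans (mul_one _).symm

theorem D_D_D_eq_zero_iff {τ : C} :
    D (D (D τ)) = 0 ↔ ∃ τ₀ τ₁ τ₂ : ℝ, ∀ t : ℝ, τ.1 t = τ₂ * t ^ 2 + τ₁ * t + τ₀ := by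
  constructor
  · intro h
    obtain ⟨a, ha⟩ : ∃ a : ℝ, D (D τ) = a • 1 := ⟨_, eq_smul_one_of_D_eq_zero h⟩
    obtain ⟨b, hb⟩ : ∃ b : ℝ, D τ - a • time = b • 1 :=
      ⟨_, eq_smul_one_of_D_eq_zero (by rw [map_sub, ha, D.map_smul, D_time, sub_self])⟩
    obtain ⟨c, hc⟩ : ∃ c : ℝ, τ - b • time - (a / 2) • (time * time) = c • 1 := by
      refine ⟨_, eq_smul_one_of_D_eq_zero ?_⟩
      rw [map_sub, map_sub, D.map_smul, D.map_smul, D_mul, D_time, ← hb]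
      ext t
      simp only [C.sub_apply, C.smul_apply, C.add_apply, C.mul_apply, C.one_apply, C.zero_apply]
      ring
    refine ⟨c, b, a / 2, fun t => ?_⟩
    have ht := congrArg (·.1 t) hc
    simp only [C.sub_apply, C.smul_apply, C.mul_apply, C.one_apply, time_apply] at ht
    linear_combination ht
  · rintro ⟨c, b, a, h⟩
    obtain rfl : τ = a • (time * time) + b • time + c • 1 := by
      ext t
      simp only [C.add_apply, C.smul_apply, C.mul_apply, C.one_apply, time_apply, h]
      ring
    simp [D_time]

theorem not_finiteDimensional_C : ¬ FiniteDimensional ℝ C := by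
  intro _
  have hinj : Function.Injective (Polynomial.aeval (R := ℝ) time) := fun p q hpq =>
    Polynomial.funext fun t => by
      have h := congrArg (·.1 t) hpq
      simpa [Polynomial.aeval_subalgebra_coe, Polynomial.aeval_fn_apply] using h
  exact Polynomial.not_finite (Module.Finite.of_injective
    (Polynomial.aeval (R := ℝ) time).toLinearMap hinj)

/-! ### Solvable ideals -/

section Solvable

variable {𝕜 L M : Type*} [CommRing 𝕜] [LieRing L] [LieAlgebra 𝕜 L] [LieRing M] [LieAlgebra 𝕜 M]

theorem isSolvable_of_lie_lie_lie_eq_zero (h : ∀ x y z w : L, ⁅⁅x, y⁆, ⁅z, w⁆⁆ = 0) :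
    LieAlgebra.IsSolvable L := by
  refine LieAlgebra.IsSolvable.mk (R := ℤ) (k := 2) ?_
  rw [LieAlgebra.derivedSeries_def, LieAlgebra.derivedSeriesOfIdeal_succ,
    LieAlgebra.derivedSeriesOfIdeal_succ, LieAlgebra.derivedSeriesOfIdeal_zero, eq_bot_iff,
    LieSubmodule.lie_le_iff]
  intro x hx y hy
  rw [← LieSubmodule.mem_toSubmodule, LieSubmodule.lieIdeal_oper_eq_linear_span'] at hx hy
  rw [LieSubmodule.mem_bot]
  induction hx, hy using Submodule.span_induction₂ with
  | mem_mem x y hx hy =>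
    obtain ⟨⟨a, -, b, -, rfl⟩, ⟨c, -, d, -, rfl⟩⟩ := hx, hy
    exact h a b c d
  | zero_left y _ => exact zero_lie y
  | zero_right x _ => exact lie_zero x
  | add_left x y z _ _ _ hx hy => rw [add_lie, hx, hy, add_zero]
  | add_right x y z _ _ _ hx hy => rw [lie_add, hx, hy, add_zero]
  | smul_left r x y _ _ h => rw [smul_lie, h, smul_zero]
  | smul_right r x y _ _ h => rw [lie_smul, h, smul_zero]

theorem isSolvable_map {π : L →ₗ⁅𝕜⁆ M} (hπ : Function.Surjective π) (I : LieIdeal 𝕜 L)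
    [LieAlgebra.IsSolvable I] : LieAlgebra.IsSolvable (I.map π) := by
  let f : I →ₗ⁅𝕜⁆ (I.map π) :=
    { toFun := fun x => ⟨π x, LieIdeal.mem_map x.2⟩
      map_add' := fun x y => Subtype.ext (map_add π x.1 y.1)
      map_smul' := fun c x => Subtype.ext (map_smul π c x.1)
      map_lie' := fun {x y} => Subtype.ext (LieHom.map_lie π x.1 y.1) }
  refine Function.Surjective.lieAlgebra_isSolvable (f := f) ?_
  rintro ⟨y, hy⟩
  obtain ⟨x, rfl⟩ := LieIdeal.mem_map_of_surjective hπ hy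
  exact ⟨x, rfl⟩

variable [LieAlgebra.HasTrivialRadical 𝕜 M]

theorem radical_eq_ker {π : L →ₗ⁅𝕜⁆ M} (hπ : Function.Surjective π)
    [hker : LieAlgebra.IsSolvable π.ker] : LieAlgebra.radical 𝕜 L = π.ker := by
  refine le_antisymm (sSup_le fun I (hI : LieAlgebra.IsSolvable I) v hv => ?_) (le_sSup hker)
  have := isSolvable_map hπ I
  have hmem : π v ∈ I.map π := LieIdeal.mem_map hv
  rwa [LieAlgebra.HasTrivialRadical.eq_bot_of_isSolvable (I.map π)] at hmem

theorem hasTrivialRadical_of_bijective {π : L →ₗ⁅𝕜⁆ M} (hπ : Function.Bijective π) :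
    LieAlgebra.HasTrivialRadical 𝕜 L := by
  have hker : π.ker = ⊥ := (LieHom.ker_eq_bot π).2 hπ.1
  have : LieAlgebra.IsSolvable π.ker := hker ▸ inferInstance
  exact ⟨(radical_eq_ker hπ.2).trans hker⟩

end Solvable

theorem isLeviDecomposition_ker {L M : Type} [LieRing L] [LieAlgebra ℝ L] [LieRing M]
    [LieAlgebra ℝ M] [LieAlgebra.HasTrivialRadical ℝ M] {π : L →ₗ⁅ℝ⁆ M} {𝔰 : LieSubalgebra ℝ L}
    (h𝔰 : Function.Bijective fun s : 𝔰 => π s) (hker : LieAlgebra.IsSolvable π.ker) :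
    IsLeviDecomposition 𝔰 π.ker where
  solvable := hker
  radical_eq := radical_eq_ker fun a => (h𝔰.2 a).imp' _ fun _ h => h
  semisimple := hasTrivialRadical_of_bijective (π := π.comp 𝔰.incl) h𝔰
  isCompl := by
    refine ⟨Submodule.disjoint_def.2 fun v hv hv0 => ?_,
      codisjoint_iff.2 (eq_top_iff.2 fun v _ => ?_)⟩
    · exact congrArg Subtype.val (@h𝔰.1 ⟨v, hv⟩ 0 (hv0.trans (map_zero π).symm))
    · obtain ⟨s, hs : π s = π v⟩ := h𝔰.2 (π v)
      refine Submodule.mem_sup.2 ⟨s, s.2, v - s, ?_, add_sub_cancel _ _⟩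
      exact (map_sub π v s).trans (sub_eq_zero.2 hs.symm)

/-! ### The Virasoro algebra -/

theorem Vir.eq_zero_of_lie_lie_eq_zero {a : Vir} (h : ∀ b : Vir, ⁅a, ⁅b, a⁆⁆ = 0) : a = 0 := by
  refine Vir.coeff.injective (C.ext fun t => ?_)
  -- The coefficient `(s - t) ^ 2` vanishes with its first derivative at `s = t`, so that only the
  -- term `-2 a(t) ^ 2` of the double commutator survives there.
  have hlie : ∀ f : C, a.coeff * D (f * D a.coeff - D f * a.coeff)
      - D a.coeff * (f * D a.coeff - D f * a.coeff) = 0 := fun f =>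
    congrArg Vir.coeff (h (Vir.of f))
  have ht := congrArg (·.1 t) (hlie ((time - t • 1) * (time - t • 1)))
  simpa [D_mul, D_time] using ht

instance : LieAlgebra.HasTrivialRadical ℝ Vir := by
  rw [LieAlgebra.hasTrivialRadical_iff_no_abelian_ideals]
  refine fun I hI => eq_bot_iff.2 fun a ha => Vir.eq_zero_of_lie_lie_eq_zero fun b => ?_
  exact congrArg Subtype.val (hI.trivial ⟨a, ha⟩ ⟨⁅b, a⁆, lie_mem_right ℝ Vir I b a ha⟩)

/-! ### The embedding into a Kac–Moody–Virasoro algebra -/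

attribute [local instance 100] LieRing.ofAssociativeRing LieAlgebra.ofAssociativeAlgebra

/-- The current matrix of the general element for `δ₁ = -ε₁`. This field preserves the
`C^∞(ℝ)`-module with the basis `1, x, y, xy, x² + ε₁y², x²y + (ε₁/3)y³, φ, θ`, where `θ` is the
argument of `ψ`; the matrix is that of its action, made trace-free by adding `-τ'/2` times the
identity. -/
def currentMatrix (ε₁ : ℝ) : Coeffs → Matrix (Fin 8) (Fin 8) C := fun (τ, α, β, μ, γ, δ) =>
  !![-(1 / 2 : ℝ) • D τ, α, β, 0, 0, 0, δ, -μ;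
    0, 0, 0, β, (2 : ℝ) • α, 0, γ, (1 / 2 : ℝ) • D α;
    0, 0, 0, α, (2 * ε₁) • β, 0, D μ, (ε₁ / 2) • D β;
    0, 0, 0, (1 / 2 : ℝ) • D τ, 0, (2 : ℝ) • α, -(1 / 2 : ℝ) • D (D α), 0;
    0, 0, 0, 0, (1 / 2 : ℝ) • D τ, β, -(1 / 4 : ℝ) • D (D β), (1 / 8 : ℝ) • D (D τ);
    0, 0, 0, 0, 0, D τ, -(1 / 8 : ℝ) • D (D (D τ)), 0;
    0, 0, 0, 0, 0, 0, -D τ, 0;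
    0, 0, 0, 0, 0, 0, 0, -(1 / 2 : ℝ) • D τ]

theorem trace_currentMatrix (ε₁ : ℝ) (c : Coeffs) : (currentMatrix ε₁ c).trace = 0 := by
  ext t
  simp [Matrix.trace, Fin.sum_univ_eight, currentMatrix]

theorem currentMatrix_mulVec (ε₁ : ℝ) (τ α β μ γ δ : C) (v : Fin 8 → C) :
    (currentMatrix ε₁ (τ, α, β, μ, γ, δ)).mulVec v =
      ![-(1 / 2 : ℝ) • D τ * v 0 + α * v 1 + β * v 2 + δ * v 6 - μ * v 7,
        β * v 3 + (2 : ℝ) • α * v 4 + γ * v 6 + (1 / 2 : ℝ) • D α * v 7,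
        α * v 3 + (2 * ε₁) • β * v 4 + D μ * v 6 + (ε₁ / 2) • D β * v 7,
        (1 / 2 : ℝ) • D τ * v 3 + (2 : ℝ) • α * v 5 - (1 / 2 : ℝ) • D (D α) * v 6,
        (1 / 2 : ℝ) • D τ * v 4 + β * v 5 - (1 / 4 : ℝ) • D (D β) * v 6
          + (1 / 8 : ℝ) • D (D τ) * v 7,
        D τ * v 5 - (1 / 8 : ℝ) • D (D (D τ)) * v 6,
        -D τ * v 6,
        -(1 / 2 : ℝ) • D τ * v 7] := by
  ext i t
  fin_cases i <;>
    simp [currentMatrix, Matrix.mulVec, dotProduct, Fin.sum_univ_eight] <;> ring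

theorem currentMatrix_add (ε₁ : ℝ) (c c' : Coeffs) :
    currentMatrix ε₁ (c + c') = currentMatrix ε₁ c + currentMatrix ε₁ c' := by
  obtain ⟨⟨τ, α, β, μ, γ, δ⟩, ⟨τ', α', β', μ', γ', δ'⟩⟩ := c, c'
  refine Matrix.mulVec_injective (funext fun v => ?_)
  simp only [Matrix.add_mulVec, Prod.mk_add_mk, currentMatrix_mulVec, map_add]
  ext i t
  fin_cases i <;> dsimp <;> ring

theorem currentMatrix_smul (ε₁ r : ℝ) (c : Coeffs) :
    currentMatrix ε₁ (r • c) = r • currentMatrix ε₁ c := by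
  obtain ⟨τ, α, β, μ, γ, δ⟩ := c
  refine Matrix.mulVec_injective (funext fun v => ?_)
  simp only [Matrix.smul_mulVec, Prod.smul_mk, currentMatrix_mulVec, D.map_smul]
  ext i t
  fin_cases i <;> dsimp <;> ring

theorem currentMatrix_map_D (ε₁ : ℝ) (τ α β μ γ δ : C) :
    (currentMatrix ε₁ (τ, α, β, μ, γ, δ)).map D =
      currentMatrix ε₁ (D τ, D α, D β, D μ, D γ, D δ) := by
  refine Matrix.ext fun i j => ?_
  rw [Matrix.map_apply]
  fin_cases i <;> fin_cases j <;>
    first | exact map_zero D | rfl | exact map_neg D _ | exact D.map_smul _ _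

theorem currentMatrix_lieCoeffs {ε₁ : ℝ} (hε₁ : ε₁ = 1 ∨ ε₁ = -1) (c c' : Coeffs) :
    currentMatrix ε₁ (lieCoeffs ε₁ (-ε₁) c c') =
      ⁅currentMatrix ε₁ c, currentMatrix ε₁ c'⁆ + c.1 • (currentMatrix ε₁ c').map D
        - c'.1 • (currentMatrix ε₁ c).map D := by
  obtain ⟨⟨τ, α, β, μ, γ, δ⟩, ⟨τ', α', β', μ', γ', δ'⟩⟩ := c, c'
  refine Matrix.mulVec_injective (funext fun v => ?_)
  rw [currentMatrix_map_D, currentMatrix_map_D, Ring.lie_def, Matrix.sub_mulVec,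
    Matrix.add_mulVec, Matrix.sub_mulVec, ← Matrix.mulVec_mulVec, ← Matrix.mulVec_mulVec,
    Matrix.smul_mulVec, Matrix.smul_mulVec]
  simp only [lieCoeffs, currentMatrix_mulVec, D_mul, map_add, map_sub, D.map_smul]
  ext i t
  fin_cases i <;> dsimp <;> rcases hε₁ with rfl | rfl <;> ring

/-! ### The case `δ₁ = -ε₁` -/

section Levi

variable {ε₁ : ℝ} (hε₁ : ε₁ = 1 ∨ ε₁ = -1)

/-- The linear parametrization of the symmetry algebra for `δ₁ = -ε₁` by six arbitrary functions. -/
def fieldEquiv : Coeffs ≃ₗ[ℝ] symmetryAlgebra hε₁ (-ε₁) :=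
  LinearEquiv.ofBijective
    ((generalField ε₁ (-ε₁)).codRestrict (symmetryAlgebra hε₁ (-ε₁)).toSubmodule
      fun c => ⟨c, by simp, rfl⟩)
    ⟨fun _ _ h => generalField_injective ε₁ (-ε₁) (congrArg Subtype.val h),
      fun ⟨_, c, _, h⟩ => ⟨c, Subtype.ext h.symm⟩⟩

theorem coe_fieldEquiv (c : Coeffs) : (fieldEquiv hε₁ c : VF) = generalField ε₁ (-ε₁) c := rfl

theorem lie_fieldEquiv (c c' : Coeffs) :
    ⁅fieldEquiv hε₁ c, fieldEquiv hε₁ c'⁆ = fieldEquiv hε₁ (lieCoeffs ε₁ (-ε₁) c c') :=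
  Subtype.ext (lie_generalField hε₁ (by simp))

theorem fieldEquiv_symm_lie (v v' : symmetryAlgebra hε₁ (-ε₁)) :
    (fieldEquiv hε₁).symm ⁅v, v'⁆ =
      lieCoeffs ε₁ (-ε₁) ((fieldEquiv hε₁).symm v) ((fieldEquiv hε₁).symm v') := by
  rw [LinearEquiv.symm_apply_eq, ← lie_fieldEquiv, LinearEquiv.apply_symm_apply,
    LinearEquiv.apply_symm_apply]

/-- The embedding of the symmetry algebra into the Kac–Moody–Virasoro algebra of `sl(8)`: the field
with the coefficients `c = (τ, …)` is mapped to its current matrix and to `τ d/dt`. -/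
def toKMV : symmetryAlgebra hε₁ (-ε₁) →ₗ⁅ℝ⁆ KMV 8 where
  toFun v := ⟨⟨currentMatrix ε₁ ((fieldEquiv hε₁).symm v), trace_currentMatrix _ _⟩,
    Vir.of ((fieldEquiv hε₁).symm v).1⟩
  map_add' v v' := by
    have hadd := map_add (fieldEquiv hε₁).symm v v'
    refine LieAlgebra.SemiDirectSum.ext (Subtype.ext ?_)
      (congrArg (fun c : Coeffs => Vir.of c.1) hadd)
    exact (congrArg (currentMatrix ε₁) hadd).trans (currentMatrix_add ..)
  map_smul' r v := by
    have hsmul := map_smul (fieldEquiv hε₁).symm r v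
    refine LieAlgebra.SemiDirectSum.ext (Subtype.ext ?_)
      (congrArg (fun c : Coeffs => Vir.of c.1) hsmul)
    exact (congrArg (currentMatrix ε₁) hsmul).trans (currentMatrix_smul ..)
  map_lie' {v v'} := by
    have hlie := fieldEquiv_symm_lie hε₁ v v'
    refine LieAlgebra.SemiDirectSum.ext (Subtype.ext ?_)
      (congrArg (fun c : Coeffs => Vir.of c.1) hlie)
    exact (congrArg (currentMatrix ε₁) hlie).trans (currentMatrix_lieCoeffs hε₁ _ _)

theorem toKMV_injective : Function.Injective (toKMV hε₁) := by
  intro v v' h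
  have hτ : ((fieldEquiv hε₁).symm v).1 = ((fieldEquiv hε₁).symm v').1 :=
    congrArg LieAlgebra.SemiDirectSum.right h
  have hA (i j : Fin 8) : currentMatrix ε₁ ((fieldEquiv hε₁).symm v) i j =
      currentMatrix ε₁ ((fieldEquiv hε₁).symm v') i j :=
    congrArg (fun a : KMV 8 => a.left.1 i j) h
  exact (fieldEquiv hε₁).symm.injective (Prod.ext hτ (Prod.ext (hA 0 1) (Prod.ext (hA 0 2)
    (Prod.ext (neg_injective (hA 0 7)) (Prod.ext (hA 1 6) (hA 0 6))))))

/-- The projection of the symmetry algebra onto the Virasoro algebra. -/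
def toVir : symmetryAlgebra hε₁ (-ε₁) →ₗ⁅ℝ⁆ Vir :=
  (LieAlgebra.SemiDirectSum.projr (Vir.act 8)).comp (toKMV hε₁)

theorem toVir_fieldEquiv (c : Coeffs) : toVir hε₁ (fieldEquiv hε₁ c) = Vir.of c.1 :=
  congrArg (fun c : Coeffs => Vir.of c.1) ((fieldEquiv hε₁).symm_apply_apply c)

theorem fieldEquiv_mem_ker_toVir {c : Coeffs} : fieldEquiv hε₁ c ∈ (toVir hε₁).ker ↔ c.1 = 0 := by
  rw [LieHom.mem_ker, toVir_fieldEquiv, map_eq_zero_iff _ Vir.of.injective]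

theorem mem_ker_toVir {v : symmetryAlgebra hε₁ (-ε₁)} :
    v ∈ (toVir hε₁).ker ↔ ∃ α β μ γ δ : C,
      (v : VF) = Y α + Z ε₁ (-ε₁) β + W μ + R γ + S δ := by
  have hfield (α β μ γ δ : C) : (fieldEquiv hε₁ (0, α, β, μ, γ, δ) : VF) =
      Y α + Z ε₁ (-ε₁) β + W μ + R γ + S δ := by
    have hX : X ε₁ 0 = 0 := (X_eq_generalField ε₁ 0 0).trans (map_zero (generalField ε₁ 0))
    rw [coe_fieldEquiv, generalField_apply, hX, zero_add]
  constructor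
  · obtain ⟨⟨τ, α, β, μ, γ, δ⟩, rfl⟩ := (fieldEquiv hε₁).surjective v
    intro hv
    obtain rfl : τ = 0 := (fieldEquiv_mem_ker_toVir hε₁).1 hv
    exact ⟨α, β, μ, γ, δ, hfield α β μ γ δ⟩
  · rintro ⟨α, β, μ, γ, δ, hv⟩
    obtain rfl : v = fieldEquiv hε₁ (0, α, β, μ, γ, δ) :=
      Subtype.ext (hv.trans (hfield α β μ γ δ).symm)
    exact (fieldEquiv_mem_ker_toVir hε₁).2 rfl

theorem isSolvable_ker_toVir : LieAlgebra.IsSolvable (toVir hε₁).ker := by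
  refine isSolvable_of_lie_lie_lie_eq_zero fun x y z w => Subtype.ext ?_
  have hcoeffs (v : (toVir hε₁).ker) : ((fieldEquiv hε₁).symm v.1).1 = 0 :=
    (fieldEquiv_mem_ker_toVir hε₁).1 (by rw [LinearEquiv.apply_symm_apply]; exact v.2)
  refine (fieldEquiv hε₁).symm.injective ?_
  simp only [LieSubmodule.coe_bracket, LieIdeal.coe_bracket_of_module]
  change (fieldEquiv hε₁).symm ⁅⁅x.1, y.1⁆, ⁅z.1, w.1⁆⁆ = (fieldEquiv hε₁).symm 0
  simp [fieldEquiv_symm_lie, lieCoeffs, hcoeffs, Prod.zero_eq_mk]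

/-- The subalgebra `{X(τ)}`. -/
def leviFactor : LieSubalgebra ℝ (symmetryAlgebra hε₁ (-ε₁)) where
  carrier := {v | ∃ τ : C, v = fieldEquiv hε₁ (τ, 0)}
  add_mem' := by
    rintro _ _ ⟨τ, rfl⟩ ⟨τ', rfl⟩
    exact ⟨τ + τ', by rw [← map_add, Prod.mk_add_mk, add_zero]⟩
  zero_mem' := ⟨0, (map_zero _).symm⟩
  smul_mem' := by
    rintro r _ ⟨τ, rfl⟩
    exact ⟨r • τ, by rw [← map_smul, Prod.smul_mk, smul_zero]⟩
  lie_mem' := by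
    rintro _ _ ⟨τ, rfl⟩ ⟨τ', rfl⟩
    refine ⟨τ * D τ' - D τ * τ', (lie_fieldEquiv hε₁ _ _).trans (congrArg _ ?_)⟩
    simp [lieCoeffs, Prod.ext_iff]

theorem mem_leviFactor {v : symmetryAlgebra hε₁ (-ε₁)} :
    v ∈ leviFactor hε₁ ↔ ∃ τ : C, (v : VF) = X ε₁ τ := by
  refine exists_congr fun τ => ?_
  rw [X_eq_generalField ε₁ (-ε₁) τ]
  exact Subtype.ext_iff

theorem bijective_toVir_leviFactor : Function.Bijective fun s : leviFactor hε₁ => toVir hε₁ s := by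
  refine ⟨?_, fun a => ⟨⟨_, a.coeff, rfl⟩, toVir_fieldEquiv hε₁ _⟩⟩
  rintro ⟨_, τ, rfl⟩ ⟨_, τ', rfl⟩ h
  simp only [toVir_fieldEquiv] at h
  obtain rfl : τ = τ' := Vir.of.injective h
  rfl

theorem isLeviDecomposition_symmetryAlgebra :
    IsLeviDecomposition (leviFactor hε₁) (toVir hε₁).ker :=
  isLeviDecomposition_ker (bijective_toVir_leviFactor hε₁) (isSolvable_ker_toVir hε₁)

theorem not_finiteDimensional_ker_toVir : ¬ FiniteDimensional ℝ (toVir hε₁).ker := by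
  intro (_ : FiniteDimensional ℝ (toVir hε₁).ker.toSubmodule)
  let coeff : (toVir hε₁).ker.toSubmodule →ₗ[ℝ] C :=
    LinearMap.fst ℝ C _ ∘ₗ LinearMap.snd ℝ C _ ∘ₗ (fieldEquiv hε₁).symm.toLinearMap ∘ₗ
      (toVir hε₁).ker.toSubmodule.subtype
  have hcoeff : Function.Surjective coeff := fun α =>
    ⟨⟨fieldEquiv hε₁ (0, α, 0), (fieldEquiv_mem_ker_toVir hε₁).2 rfl⟩,
      congrArg (·.2.1) ((fieldEquiv hε₁).symm_apply_apply (0, α, 0))⟩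
  exact not_finiteDimensional_C (Module.Finite.of_surjective coeff hcoeff)

theorem not_finiteDimensional_symmetryAlgebra :
    ¬ FiniteDimensional ℝ (symmetryAlgebra hε₁ (-ε₁)) := fun _ =>
  not_finiteDimensional_ker_toVir hε₁
    (inferInstanceAs (FiniteDimensional ℝ (toVir hε₁).ker.toSubmodule))

theorem isKacMoodyVirasoro_symmetryAlgebra :
    IsKacMoodyVirasoro (leviFactor hε₁) (toVir hε₁).ker :=
  ⟨8, toKMV hε₁, toKMV_injective hε₁, bijective_toVir_leviFactor hε₁, fun _ => LieHom.mem_ker ..,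
    not_finiteDimensional_ker_toVir hε₁⟩

end Levi

end DaveyStewartson

end

open DaveyStewartson in
theorem mainTheorem2_general (ε₁ ε₂ δ₁ δ₂ : ℝ)
    (hε₁ : ε₁ = 1 ∨ ε₁ = -1) (hε₂ : ε₂ ≠ 0) :
    ∃ L : LieSubalgebra ℝ VF,
      (∀ V : VF, V ∈ L ↔ IsSymmetry ε₁ ε₂ δ₁ δ₂ V) ∧
      (∀ V : VF, V ∈ L ↔ ∃ τ α β μ γ δ : C, (ε₁ + δ₁) • D (D (D τ)) = 0 ∧
        V = X ε₁ τ + Y α + Z ε₁ δ₁ β + W μ + R γ + S δ) ∧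
      (∀ τ α β μ γ δ τ' α' β' μ' γ' δ' : C,
        X ε₁ τ + Y α + Z ε₁ δ₁ β + W μ + R γ + S δ
            = X ε₁ τ' + Y α' + Z ε₁ δ₁ β' + W μ' + R γ' + S δ' →
          τ = τ' ∧ α = α' ∧ β = β' ∧ μ = μ' ∧ γ = γ' ∧ δ = δ') ∧
      (∀ τ : C,
        (∀ τ₂ : C, ⁅X ε₁ τ, X ε₁ τ₂⁆ = X ε₁ (τ * D τ₂ - D τ * τ₂)) ∧
        (∀ α : C, ⁅X ε₁ τ, Y α⁆ = Y (τ * D α - (1 / 2 : ℝ) • (D τ * α))) ∧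
        ((ε₁ + δ₁) • D (D (D τ)) = 0 → ∀ β : C,
          ⁅X ε₁ τ, Z ε₁ δ₁ β⁆ = Z ε₁ δ₁ (τ * D β - (1 / 2 : ℝ) • (D τ * β))) ∧
        (∀ μ : C, ⁅X ε₁ τ, W μ⁆ = W (τ * D μ)) ∧
        (∀ γ : C, ⁅X ε₁ τ, R γ⁆ = R (τ * D γ + D τ * γ)) ∧
        (∀ δ : C, ⁅X ε₁ τ, S δ⁆ = S (τ * D δ + (1 / 2 : ℝ) • (D τ * δ)))) ∧
      (∀ α₁ α₂ : C, ⁅Y α₁, Y α₂⁆ = -(1 / 2 : ℝ) • W (α₁ * D α₂ - D α₁ * α₂)) ∧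
      (∀ β₁ β₂ : C,
        ⁅Z ε₁ δ₁ β₁, Z ε₁ δ₁ β₂⁆ = -(ε₁ / 2) • W (β₁ * D β₂ - D β₁ * β₂)) ∧
      (∀ α β : C,
        ⁅Y α, Z ε₁ δ₁ β⁆ = (1 / 2 : ℝ) • R (D (D α) * β + (δ₁ * ε₁) • (α * D (D β)))) ∧
      (∀ α γ : C, ⁅Y α, R γ⁆ = S (α * γ)) ∧
      (∀ β μ : C, ⁅Z ε₁ δ₁ β, W μ⁆ = S (β * D μ)) ∧
      (∀ f g : C, ⁅Y f, W g⁆ = 0 ∧ ⁅Y f, S g⁆ = 0 ∧ ⁅Z ε₁ δ₁ f, R g⁆ = 0 ∧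
        ⁅Z ε₁ δ₁ f, S g⁆ = 0 ∧ ⁅W f, W g⁆ = 0 ∧ ⁅W f, R g⁆ = 0 ∧ ⁅W f, S g⁆ = 0 ∧
        ⁅R f, R g⁆ = 0 ∧ ⁅R f, S g⁆ = 0 ∧ ⁅S f, S g⁆ = 0) ∧
      (δ₁ = -ε₁ →
        (∀ V : VF, V ∈ L ↔ ∃ τ α β μ γ δ : C,
          V = X ε₁ τ + Y α + Z ε₁ δ₁ β + W μ + R γ + S δ) ∧
        ¬ FiniteDimensional ℝ L ∧
        ∃ (𝔰 : LieSubalgebra ℝ L) (𝔫 : LieIdeal ℝ L),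
          (∀ v : L, v ∈ 𝔰 ↔ ∃ τ : C, (v : VF) = X ε₁ τ) ∧
          (∀ v : L, v ∈ 𝔫 ↔ ∃ α β μ γ δ : C,
            (v : VF) = Y α + Z ε₁ δ₁ β + W μ + R γ + S δ) ∧
          IsLeviDecomposition 𝔰 𝔫 ∧ IsKacMoodyVirasoro 𝔰 𝔫) ∧
      (δ₁ ≠ -ε₁ →
        ∀ V : VF, V ∈ L ↔ ∃ τ α β μ γ δ : C,
          (∃ τ₀ τ₁ τ₂ : ℝ, ∀ t : ℝ, τ.1 t = τ₂ * t ^ 2 + τ₁ * t + τ₀) ∧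
          V = X ε₁ τ + Y α + Z ε₁ δ₁ β + W μ + R γ + S δ) := by
  refine ⟨symmetryAlgebra hε₁ δ₁, fun V => (isSymmetry_iff_exists_generalField hε₁ hε₂).symm,
    fun V => mem_symmetryAlgebra hε₁ δ₁, fun τ α β μ γ δ τ' α' β' μ' γ' δ' h => ?_,
    fun τ => ⟨lie_X_X hε₁ τ, lie_X_Y hε₁ τ, lie_X_Z hε₁ δ₁, lie_X_W hε₁ τ,
      lie_X_R hε₁ τ, lie_X_S hε₁ τ⟩,
    lie_Y_Y, lie_Z_Z hε₁ δ₁, lie_Y_Z hε₁ δ₁, lie_Y_R, lie_Z_W hε₁ δ₁,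
    fun f g => ⟨lie_Y_W f g, lie_Y_S f g, lie_Z_R hε₁ δ₁ f g, lie_Z_S hε₁ δ₁ f g,
      lie_W_W f g, lie_W_R f g, lie_W_S f g, lie_R_R f g, lie_R_S f g, lie_S_S f g⟩,
    ?_, fun hδ₁ V => ?_⟩
  · simpa only [Prod.mk.injEq] using
      @generalField_injective ε₁ δ₁ (τ, α, β, μ, γ, δ) (τ', α', β', μ', γ', δ') h
  · rintro rfl
    refine ⟨fun V => by simp only [mem_symmetryAlgebra, add_neg_cancel, zero_smul, true_and],
      not_finiteDimensional_symmetryAlgebra hε₁, leviFactor hε₁, (toVir hε₁).ker,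
      fun v => mem_leviFactor hε₁, fun v => mem_ker_toVir hε₁,
      isLeviDecomposition_symmetryAlgebra hε₁, isKacMoodyVirasoro_symmetryAlgebra hε₁⟩
  · have hne : ε₁ + δ₁ ≠ 0 := fun h => hδ₁ (eq_neg_of_add_eq_zero_right h)
    simp only [mem_symmetryAlgebra, smul_eq_zero_iff_right hne, D_D_D_eq_zero_iff]

open DaveyStewartson in
theorem mainTheorem2 (ε₁ ε₂ δ₁ δ₂ : ℝ)
    (hε₁ : ε₁ = 1 ∨ ε₁ = -1) (hε₂ : ε₂ = 1 ∨ ε₂ = -1) :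
    -- the infinitesimal symmetries form a Lie algebra `L`
    ∃ L : LieSubalgebra ℝ VF,
      (∀ V : VF, V ∈ L ↔ IsSymmetry ε₁ ε₂ δ₁ δ₂ V) ∧
      -- its elements, for every `δ₁`
      (∀ V : VF, V ∈ L ↔ ∃ τ α β μ γ δ : C, (ε₁ + δ₁) • D (D (D τ)) = 0 ∧
        V = X ε₁ τ + Y α + Z ε₁ δ₁ β + W μ + R γ + S δ) ∧
      -- the six functions are determined by the vector field
      (∀ τ α β μ γ δ τ' α' β' μ' γ' δ' : C,
        X ε₁ τ + Y α + Z ε₁ δ₁ β + W μ + R γ + S δ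
            = X ε₁ τ' + Y α' + Z ε₁ δ₁ β' + W μ' + R γ' + S δ' →
          τ = τ' ∧ α = α' ∧ β = β' ∧ μ = μ' ∧ γ = γ' ∧ δ = δ') ∧
      -- the commutators with `X(τ)`
      (∀ τ : C, (ε₁ + δ₁) • D (D (D τ)) = 0 →
        (∀ τ₂ : C, (ε₁ + δ₁) • D (D (D τ₂)) = 0 →
          ⁅X ε₁ τ, X ε₁ τ₂⁆ = X ε₁ (τ * D τ₂ - D τ * τ₂)) ∧
        (∀ α : C, ⁅X ε₁ τ, Y α⁆ = Y (τ * D α - (1 / 2 : ℝ) • (D τ * α))) ∧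
        (∀ β : C, ⁅X ε₁ τ, Z ε₁ δ₁ β⁆ = Z ε₁ δ₁ (τ * D β - (1 / 2 : ℝ) • (D τ * β))) ∧
        (∀ μ : C, ⁅X ε₁ τ, W μ⁆ = W (τ * D μ)) ∧
        (∀ γ : C, ⁅X ε₁ τ, R γ⁆ = R (τ * D γ + D τ * γ)) ∧
        (∀ δ : C, ⁅X ε₁ τ, S δ⁆ = S (τ * D δ + (1 / 2 : ℝ) • (D τ * δ)))) ∧
      -- the other nonzero commutators
      (∀ α₁ α₂ : C, ⁅Y α₁, Y α₂⁆ = -(1 / 2 : ℝ) • W (α₁ * D α₂ - D α₁ * α₂)) ∧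
      (∀ β₁ β₂ : C,
        ⁅Z ε₁ δ₁ β₁, Z ε₁ δ₁ β₂⁆ = -(ε₁ / 2) • W (β₁ * D β₂ - D β₁ * β₂)) ∧
      (∀ α β : C,
        ⁅Y α, Z ε₁ δ₁ β⁆ = (1 / 2 : ℝ) • R (D (D α) * β + (δ₁ * ε₁) • (α * D (D β)))) ∧
      (∀ α γ : C, ⁅Y α, R γ⁆ = S (α * γ)) ∧
      (∀ β μ : C, ⁅Z ε₁ δ₁ β, W μ⁆ = S (β * D μ)) ∧
      -- the vanishing commutators
      (∀ f g : C, ⁅Y f, W g⁆ = 0 ∧ ⁅Y f, S g⁆ = 0 ∧ ⁅Z ε₁ δ₁ f, R g⁆ = 0 ∧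
        ⁅Z ε₁ δ₁ f, S g⁆ = 0 ∧ ⁅W f, W g⁆ = 0 ∧ ⁅W f, R g⁆ = 0 ∧ ⁅W f, S g⁆ = 0 ∧
        ⁅R f, R g⁆ = 0 ∧ ⁅R f, S g⁆ = 0 ∧ ⁅S f, S g⁆ = 0) ∧
      -- the case `δ₁ = -ε₁`
      (δ₁ = -ε₁ →
        (∀ V : VF, V ∈ L ↔ ∃ τ α β μ γ δ : C,
          V = X ε₁ τ + Y α + Z ε₁ δ₁ β + W μ + R γ + S δ) ∧
        ¬ FiniteDimensional ℝ L ∧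
        ∃ (𝔰 : LieSubalgebra ℝ L) (𝔫 : LieIdeal ℝ L),
          (∀ v : L, v ∈ 𝔰 ↔ ∃ τ : C, (v : VF) = X ε₁ τ) ∧
          (∀ v : L, v ∈ 𝔫 ↔ ∃ α β μ γ δ : C,
            (v : VF) = Y α + Z ε₁ δ₁ β + W μ + R γ + S δ) ∧
          IsLeviDecomposition 𝔰 𝔫 ∧ IsKacMoodyVirasoro 𝔰 𝔫) ∧
      -- the case `δ₁ ≠ -ε₁`
      (δ₁ ≠ -ε₁ →
        ∀ V : VF, V ∈ L ↔ ∃ τ α β μ γ δ : C,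
          (∃ τ₀ τ₁ τ₂ : ℝ, ∀ t : ℝ, τ.1 t = τ₂ * t ^ 2 + τ₁ * t + τ₀) ∧
          V = X ε₁ τ + Y α + Z ε₁ δ₁ β + W μ + R γ + S δ) := by
  obtain ⟨L, hL, hG, hinj, hX, h⟩ :=
    mainTheorem2_general ε₁ ε₂ δ₁ δ₂ hε₁ (by rcases hε₂ with rfl | rfl <;> norm_num)
  exact ⟨L, hL, hG, hinj, fun τ hτ => let ⟨hXX, hXY, hXZ, hX'⟩ := hX τ
    ⟨fun τ₂ _ => hXX τ₂, hXY, hXZ hτ, hX'⟩, h⟩
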